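/- **Theorem (Fundamental Theorem of Calculus for Lebesgue–Stieltjes integrals).** *Setting.* Let $g:\mathbb R\to\mathbb R$ be left-continuous and of bounded variation on every compact interval. Write $\operatorname{var}_g[x,y]$ for its total variation on $[x,y]$, and let $\widetilde g$ be its variation function: $\widetilde g(t)=g(0)+\operatorname{var}_g[0,t]$ for $t\ge 0$ and $\widetilde g(t)=g(0)-\operatorname{var}_g[t,0]$ for $t<0$. Let $D_g=\{t:\widetilde g(t^+)>\widetilde g(t)\}$, let $C_g$ be the open set of points $t$ such that $\widetilde g$ is constant on a neighbourhood of $t$, and let $N_g^-$ (resp. $N_g^+$) be the set of finite left (resp. right) endpoints of the connected components of $C_g$ that do not belong to $D_g$; put $N_g=N_g^-\cup N_g^+$. Let $a<b$ be real numbers with $a\notin N_g^-$ and $b\notin C_g\cup N_g^+\cup D_g$. For $t\in[a,b]$ let $t^*=t$ if $t\notin C_g$, and let $t^*$ be the right endpoint of the component of $C_g$ containing $t$ if $t\in C_g$ (then $t^*\in[a,b]$). *Measure.* Let $\mu_g$ be the finite signed Borel measure on $[a,b]$ with $\mu_g([a,t))=g(t)-g(a)$ for all $t\in[a,b]$ and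 $\mu_g(\{b\})=0$, let $\mu_g=\mu_g^+-\mu_g^-$ be its Jordan decomposition and $|\mu_g|=\mu_g^++\mu_g^-$ its total variation. Let $L^1_g([a,b),\mathbb R)$ be the space of functions that are $|\mu_g|$-integrable on $[a,b)$, and $\int_E f\,d\mu_g=\int_E f\,d\mu_g^+-\int_E f\,d\mu_g^-$. *Derivative.* A function $f:[a,b]\to\mathbb R$ has $g$-derivative $f'_g(t)=d\in\mathbb R$ at $t\in[a,b]$ if there is a function $h:[a,b]\to\mathbb R$ with $h(t^*)=0$ such that $f(s)=f(t^*)+(d+h(s))(g(s)-g(t^*))$ for all $s\in[a,b]$ with $g(s)\neq g(t^*)$, and such that $h$ is continuous at $t^*$ if $t^*\notin C_g\cup D_g\cup N_g$, right-continuous at $t^*$ if $t^*\in D_g\cup N_g^+$, and left-continuous at $t^*$ if $t^*\in N_g^-$. *Absolute continuity.* A function $F:[a,b]\to\mathbb R$ is $g$-absolutely continuous if for every $\varepsilon>0$ there is $\delta>0$ such that, for every finite family $\{(a_i,b_i)\}_{i=1}^m$ of pairwise disjoint open subintervals of $[a,b]$, $\sum_{i=1}^m\operatorname{var}_g[a_i,b_i]<\delta$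 implies $\sum_{i=1}^m|F(b_i)-F(a_i)|<\varepsilon$. *Claim.* For every $F:[a,b]\to\mathbb R$ the following are equivalent: 1. $F$ is $g$-absolutely continuous; 2. (a) $F'_g(t)$ exists for $|\mu_g|$-almost every $t\in[a,b]$; (b) $F'_g\in L^1_g([a,b),\mathbb R)$; and (c) $F(t)=F(a)+\int_{[a,t)}F'_g\,d\mu_g$ for every $t\in[a,b]$. -/

import Mathlib

namespace StieltjesFTC

open Set MeasureTheory

noncomputable section

/-- The derivators: left-continuous functions `g : ℝ → ℝ` whose restriction to every compact
interval has bounded variation. -/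
structure IsDerivator (g : ℝ → ℝ) : Prop where
  locallyBV : LocallyBoundedVariationOn g univ
  leftCont : ∀ t, ContinuousWithinAt g (Iic t) t

/-- The total variation `var_g [x, y]` as a real number. -/
def totalVar (g : ℝ → ℝ) (x y : ℝ) : ℝ := (eVariationOn g (Icc x y)).toReal

/-- The variation function `g̃`: it is `g 0 + var_g [0, t]` for `0 ≤ t` and `g 0 - var_g [t, 0]`
for `t < 0`. -/
def varFun (g : ℝ → ℝ) (t : ℝ) : ℝ :=
  if 0 ≤ t then g 0 + totalVar g 0 t else g 0 - totalVar g t 0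

/-- `D_g`: the points at which the variation function jumps. -/
def jumpSet (g : ℝ → ℝ) : Set ℝ :=
  {t | 0 < Function.rightLim (varFun g) t - varFun g t}

/-- `C_g`: the points around which the variation function is constant. -/
def constSet (g : ℝ → ℝ) : Set ℝ :=
  {t | ∃ ε > 0, ∀ s ∈ Ioo (t - ε) (t + ε), varFun g s = varFun g t}

/-- `N_g^-`: the finite left endpoints of the connected components of the open set `C_g`,
without the points of `D_g`. -/
def leftEnds (g : ℝ → ℝ) : Set ℝ :=
  {x | x ∉ constSet g ∧ ∃ y, x < y ∧ Ioo x y ⊆ constSet g} \ jumpSet g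

/-- `N_g^+`: the finite right endpoints of the connected components of the open set `C_g`,
without the points of `D_g`. -/
def rightEnds (g : ℝ → ℝ) : Set ℝ :=
  {y | y ∉ constSet g ∧ ∃ x, x < y ∧ Ioo x y ⊆ constSet g} \ jumpSet g

open Classical in
/-- The point `t^*`: it is `t` if `t ∉ C_g`, and otherwise the right endpoint of the connected
component of `C_g` containing `t`, that is, the first point after `t` outside `C_g`. -/
def starPoint (g : ℝ → ℝ) (t : ℝ) : ℝ :=
  if t ∈ constSet g then sInf {s | t < s ∧ s ∉ constSet g} else t

/-- `d` is the `g`-derivative at `t` of `f : [a, b] → ℝ`. Only the values of `f` and of the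
remainder `h` on `[a, b]` matter, and the continuity of `h` is that of a function
on `[a, b]`. -/
def HasStieltjesDerivAt (g : ℝ → ℝ) (a b : ℝ) (f : ℝ → ℝ) (d t : ℝ) : Prop :=
  ∃ h : ℝ → ℝ,
    h (starPoint g t) = 0 ∧
    (starPoint g t ∉ constSet g ∪ jumpSet g ∪ (leftEnds g ∪ rightEnds g) →
      ContinuousWithinAt h (Icc a b) (starPoint g t)) ∧
    (starPoint g t ∈ jumpSet g ∪ rightEnds g →
      ContinuousWithinAt h (Icc a b ∩ Ici (starPoint g t)) (starPoint g t)) ∧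
    (starPoint g t ∈ leftEnds g →
      ContinuousWithinAt h (Icc a b ∩ Iic (starPoint g t)) (starPoint g t)) ∧
    ∀ s ∈ Icc a b, g s ≠ g (starPoint g t) →
      f s = f (starPoint g t) + (d + h s) * (g s - g (starPoint g t))

/-- `f` is `g`-differentiable at `t`. -/
def StieltjesDifferentiableAt (g : ℝ → ℝ) (a b : ℝ) (f : ℝ → ℝ) (t : ℝ) : Prop :=
  ∃ d, HasStieltjesDerivAt g a b f d t

open Classical in
/-- The `g`-derivative `f'_g` of `f : [a, b] → ℝ`, set to `0` where it does not exist. -/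
def stieltjesDeriv (g : ℝ → ℝ) (a b : ℝ) (f : ℝ → ℝ) (t : ℝ) : ℝ :=
  if h : StieltjesDifferentiableAt g a b f t then h.choose else 0

/-- `F : [a, b] → ℝ` is `g`-absolutely continuous: absolutely continuous with respect to the
variation of `g`. -/
def GAbsolutelyContinuousOn (g : ℝ → ℝ) (a b : ℝ) (F : ℝ → ℝ) : Prop :=
  ∀ ε > 0, ∃ δ > 0, ∀ (m : ℕ) (u v : Fin m → ℝ),
    (∀ i, a ≤ u i ∧ u i < v i ∧ v i ≤ b) →
    Pairwise (fun i j => Disjoint (Ioo (u i) (v i)) (Ioo (u j) (v j))) →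
    ∑ i, totalVar g (u i) (v i) < δ →
    ∑ i, |F (v i) - F (u i)| < ε

/-- The function equal to `g` on `[a, b]`, to `g a` before `a` and to `g b` after `b`. -/
def clamp (g : ℝ → ℝ) (a b : ℝ) (t : ℝ) : ℝ := g (max a (min b t))

theorem IsDerivator.clamp_bv {g : ℝ → ℝ} (hg : IsDerivator g) (a b : ℝ) :
    BoundedVariationOn (clamp g a b) univ := by
  have hm : MonotoneOn (fun t : ℝ => max a (min b t)) univ := fun x _ y _ hxy =>
    max_le_max le_rfl (min_le_min le_rfl hxy)
  have hmaps : MapsTo (fun t : ℝ => max a (min b t)) univ (univ ∩ Icc a (max a b)) :=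
    fun x _ => ⟨trivial, le_max_left _ _, max_le_max le_rfl (min_le_left _ _)⟩
  exact ne_top_of_le_ne_top (hg.locallyBV a (max a b) trivial trivial)
    (eVariationOn.comp_le_of_monotoneOn g _ hm hmaps)

/-- The signed Lebesgue–Stieltjes measure `μ_g` on `[a, b]`, as a signed measure on `ℝ` that
vanishes outside `[a, b]`. It gives the mass `g t - g a` to `[a, t)`, for `t ∈ [a, b]`. -/
def IsDerivator.signedMeasure {g : ℝ → ℝ} (hg : IsDerivator g) (a b : ℝ) : SignedMeasure ℝ :=
  (hg.clamp_bv a b).vectorMeasure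

/-- The total variation measure `|μ_g| = μ_g^+ + μ_g^-`. -/
def IsDerivator.absMeasure {g : ℝ → ℝ} (hg : IsDerivator g) (a b : ℝ) : Measure ℝ :=
  (hg.signedMeasure a b).totalVariation

/-- The integral `∫_E f dμ_g = ∫_E f dμ_g^+ - ∫_E f dμ_g^-`. -/
def IsDerivator.integral {g : ℝ → ℝ} (hg : IsDerivator g) (a b : ℝ) (E : Set ℝ)
    (f : ℝ → ℝ) : ℝ :=
  ∫ x in E, f x ∂(hg.signedMeasure a b).toJordanDecomposition.posPart -
    ∫ x in E, f x ∂(hg.signedMeasure a b).toJordanDecomposition.negPart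

end

end StieltjesFTC

namespace StieltjesFTC

open Set MeasureTheory Filter Topology Asymptotics
open scoped ENNReal symmDiff

/-! Everything is compared with the finite measure `ν = |μ_g|`. By `totalVariation_Ico_of_leftCont`
it gives `[u, v)` the mass `var_g [u, v]`, so on `[a, b]` its distribution function `Γ s = ν (-∞,
s)` differs from the variation function by a constant. Jumps of the variation function are then
atoms of `ν`, and `C_g` is `ν`-null.

With respect to `ν`, the derivator `g` is an indefinite integral with density `ψ = ±1`
(`IsDerivator.exists_sign_density`), and a `g`-absolutely continuous `F` is one with some density
`φ`, by Radon–Nikodym (`GAbsolutelyContinuousOn.exists_density`). At `ν`-almost every `t` the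
increments of `F` and `g` are `φ t` and `ψ t` times the increment of `Γ`, up to a relatively small
error. Hence `F'_g = φ / ψ = φ * ψ`, and `∫ F'_g dμ_g = ∫ φ * ψ * ψ dν = ∫ φ dν` recovers `F`.

The expansions are immediate at atoms. Elsewhere, the quantile function of `ν` carries Lebesgue
measure on an interval to `ν` and reduces them to the classical Lebesgue differentiation theorem
(`ae_isLittleO_setIntegral_Iio`). The set `N_g` is countable, so its points that are not atoms form
a null set. The converse implication is the absolute continuity of the integral. -/

/-! ### Grid approximation and the total variation of a Stieltjes measure -/

/-- A measurable set is approximated, for a finite measure on the line, by finite unions of cells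
of a regular grid. -/
theorem exists_grid_symmDiff_lt (μ : Measure ℝ) [IsFiniteMeasure μ] {A : Set ℝ}
    (hA : MeasurableSet A) {ε : ℝ≥0∞} (hε : ε ≠ 0) :
    ∃ r : ℝ, 0 < r ∧ ∃ s : Finset ℤ,
      μ (A ∆ ⋃ k ∈ s, Ico (r * k) (r * (k + 1 : ℤ))) < ε := by
  classical
  have hε2 : ε / 2 ≠ 0 := by simpa using hε
  obtain ⟨K, hKA, hK, hμK⟩ := hA.exists_isCompact_sdiff_lt (measure_ne_top μ A) hε2
  obtain ⟨U, hAU, hU, -, hμU⟩ := hA.exists_isOpen_sdiff_lt (measure_ne_top μ A) hε2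
  obtain ⟨δ, hδ, hKδ⟩ := hK.exists_thickening_subset_open hU (hKA.trans hAU)
  obtain ⟨R, hR⟩ := hK.isBounded.subset_closedBall 0
  have hr : 0 < δ / 2 := by positivity
  set r := δ / 2 with hrdef
  -- Keep the cells that meet `K`. Their length `δ / 2` keeps them inside `U`, so their union lies
  -- between `K` and `U`.
  refine ⟨r, hr, (Finset.Icc ⌊-R / r⌋ ⌊R / r⌋).filter
    (fun k : ℤ => (Ico (r * k) (r * (k + 1 : ℤ)) ∩ K).Nonempty), ?_⟩
  refine (measure_mono (t := (A \ K) ∪ (U \ A)) ?_).trans_lt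
    ((measure_union_le _ _).trans_lt ((ENNReal.add_lt_add hμK hμU).trans_le
      (ENNReal.add_halves ε).le))
  rintro x (⟨hxA, hx⟩ | ⟨hx, hxA⟩)
  · refine Or.inl ⟨hxA, fun hxK => hx ?_⟩
    have hxR : |x| ≤ R := by simpa using hR hxK
    have hcell : x ∈ Ico (r * ⌊x / r⌋) (r * (⌊x / r⌋ + 1 : ℤ)) := by
      constructor
      · have := Int.floor_le (x / r)
        rwa [le_div_iff₀' hr] at this
      · have := Int.lt_floor_add_one (x / r)
        rw [div_lt_iff₀' hr] at this
        push_cast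
        exact this
    simp only [mem_iUnion, Finset.mem_filter, Finset.mem_Icc]
    refine ⟨⌊x / r⌋, ⟨⟨Int.floor_le_floor ?_, Int.floor_le_floor ?_⟩, x, hcell, hxK⟩, hcell⟩
    · exact div_le_div_of_nonneg_right (abs_le.1 hxR).1 hr.le
    · exact div_le_div_of_nonneg_right (abs_le.1 hxR).2 hr.le
  · simp only [mem_iUnion, Finset.mem_filter] at hx
    obtain ⟨k, ⟨-, y, hy, hyK⟩, hxk⟩ := hx
    refine Or.inr ⟨hKδ (Metric.mem_thickening_iff.2 ⟨y, hyK, ?_⟩), hxA⟩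
    rw [Real.dist_eq, abs_lt]
    obtain ⟨h1, h2⟩ := hy
    obtain ⟨h3, h4⟩ := hxk
    push_cast at h2 h4
    constructor <;> nlinarith

theorem pairwise_disjoint_grid {r : ℝ} (hr : 0 < r) :
    Pairwise (fun i j : ℤ => Disjoint (Ico (r * i) (r * (i + 1 : ℤ)))
      (Ico (r * j) (r * (j + 1 : ℤ)))) := by
  have hm : Monotone (fun k : ℤ => r * (k : ℝ)) := fun i j hij =>
    mul_le_mul_of_nonneg_left (by exact_mod_cast hij) hr.le
  exact hm.pairwise_disjoint_on_Ico_succ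

/-- The difference of the values of a signed measure is bounded by its total variation on the
symmetric difference. -/
theorem abs_signedMeasure_sub_le (m : SignedMeasure ℝ) {X Y : Set ℝ} (hX : MeasurableSet X)
    (hY : MeasurableSet Y) : |m X - m Y| ≤ m.totalVariation.real (X ∆ Y) := by
  have h1 : m X = m (X ∩ Y) + m (X \ Y) := by
    rw [← VectorMeasure.of_union (disjoint_sdiff_right.mono_left inter_subset_right)
      (hX.inter hY) (hX.diff hY), inter_union_sdiff]
  have h2 : m Y = m (X ∩ Y) + m (Y \ X) := by
    rw [inter_comm, ← VectorMeasure.of_union (disjoint_sdiff_right.mono_left inter_subset_right)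
      (hY.inter hX) (hY.diff hX), inter_union_sdiff]
  have h3 : m.totalVariation.real (X ∆ Y) =
      m.totalVariation.real (X \ Y) + m.totalVariation.real (Y \ X) :=
    measureReal_union disjoint_sdiff_sdiff (hY.diff hX)
  have h4 := m.norm_le_totalVariation (X \ Y)
  have h5 := m.norm_le_totalVariation (Y \ X)
  rw [Real.norm_eq_abs] at h4 h5
  rw [h1, h2, h3]
  calc |m (X ∩ Y) + m (X \ Y) - (m (X ∩ Y) + m (Y \ X))|
      = |m (X \ Y) - m (Y \ X)| := by ring_nf
    _ ≤ |m (X \ Y)| + |m (Y \ X)| := abs_sub _ _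
    _ ≤ _ := add_le_add h4 h5

theorem vectorMeasure_Ico_of_leftCont {f : ℝ → ℝ} (hf : BoundedVariationOn f univ)
    (hc : ∀ t, ContinuousWithinAt f (Iic t) t) {u v : ℝ} (huv : u ≤ v) :
    hf.vectorMeasure (Ico u v) = f v - f u := by
  have h : ∀ t, Function.leftLim f t = f t := fun t =>
    leftLim_eq_of_tendsto ((hc t).mono_left (nhdsWithin_mono _ Iio_subset_Iic_self))
  rw [hf.vectorMeasure_Ico huv, h, h]

/-- The two parts of the Jordan decomposition are restrictions of the total variation. -/
theorem exists_jordan_eq_restrict (m : SignedMeasure ℝ) :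
    ∃ S : Set ℝ, MeasurableSet S ∧
      m.toJordanDecomposition.posPart = m.totalVariation.restrict Sᶜ ∧
      m.toJordanDecomposition.negPart = m.totalVariation.restrict S := by
  obtain ⟨S, hS, -, -, hp, hn⟩ := m.toJordanDecomposition.exists_compl_positive_negative
  refine ⟨S, hS, ?_, ?_⟩
  · rw [SignedMeasure.totalVariation, Measure.restrict_add, Measure.restrict_eq_zero.2 hn, add_zero,
      Measure.restrict_eq_self_of_ae_mem]
    exact measure_eq_zero_iff_ae_notMem.1 hp
  · rw [SignedMeasure.totalVariation, Measure.restrict_add, Measure.restrict_eq_zero.2 hp, zero_add,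
      Measure.restrict_eq_self_of_ae_mem]
    simpa using measure_eq_zero_iff_ae_notMem.1 hn

/-- The total variation of the signed measure of a left-continuous function of bounded variation
is given on intervals by the variation of the function. -/
theorem totalVariation_Ico_of_leftCont {f : ℝ → ℝ} (hf : BoundedVariationOn f univ)
    (hc : ∀ t, ContinuousWithinAt f (Iic t) t) {u v : ℝ} (huv : u ≤ v) :
    SignedMeasure.totalVariation hf.vectorMeasure (Ico u v) = eVariationOn f (Icc u v) := by
  set m : SignedMeasure ℝ := hf.vectorMeasure with hm
  have hmI : ∀ {x y : ℝ}, x ≤ y → m (Ico x y) = f y - f x := fun h =>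
    vectorMeasure_Ico_of_leftCont hf hc h
  apply le_antisymm
  · have hfin : eVariationOn f (Icc u v) ≠ ∞ := hf.mono (subset_univ _)
    rw [← ENNReal.ofReal_toReal hfin, ← ofReal_measureReal]
    refine ENNReal.ofReal_le_ofReal (le_of_forall_pos_le_add fun ε hε => ?_)
    obtain ⟨S, hS, hp, hn⟩ := exists_jordan_eq_restrict m
    set A := Ico u v with hA
    have hAm : MeasurableSet A := measurableSet_Ico
    have hB : MeasurableSet (A ∩ Sᶜ) := hAm.inter hS.compl
    -- The measure `m` equals its total variation off the Hahn set `S` and minus it on `S`.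
    have htv : m.totalVariation.real A = 2 * m (A ∩ Sᶜ) - m A := by
      have e1 := m.apply_eq_posPart_real_sub_negPart_real hB
      have e2 := m.apply_eq_posPart_real_sub_negPart_real hAm
      rw [hp, hn, measureReal_restrict_apply hB, measureReal_restrict_apply hB] at e1
      rw [hp, hn, measureReal_restrict_apply hAm, measureReal_restrict_apply hAm] at e2
      have e3 := measureReal_inter_add_sdiff (μ := m.totalVariation) (s := A) hS
      have e4 : A ∩ Sᶜ ∩ Sᶜ = A \ S := by ext; simp
      have e5 : A ∩ Sᶜ ∩ S = ∅ := by ext; simp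
      rw [e4, e5] at e1
      rw [← sdiff_eq] at e2
      simp only [measureReal_empty, sub_zero] at e1
      linarith
    -- The error `ε / 2` is doubled by the factor `2` in `htv`.
    obtain ⟨r, hr, s, hs⟩ := exists_grid_symmDiff_lt m.totalVariation hB
      (ε := ENNReal.ofReal (ε / 2)) (by simpa using hε)
    set I : ℤ → Set ℝ := fun k => Ico (r * k) (r * (k + 1 : ℤ)) with hI
    set T := ⋃ k ∈ s, I k with hT
    have hTm : MeasurableSet T := s.measurableSet_biUnion fun _ _ => measurableSet_Ico
    have happ : |m (A ∩ Sᶜ) - m (T ∩ A)| ≤ ε / 2 := by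
      refine (abs_signedMeasure_sub_le m hB (hTm.inter hAm)).trans ?_
      refine ENNReal.toReal_le_of_le_ofReal (by positivity) ((measure_mono ?_).trans hs.le)
      rintro x (⟨⟨hx, hxS⟩, hx'⟩ | ⟨⟨hx, hxA⟩, hx'⟩)
      · exact Or.inl ⟨⟨hx, hxS⟩, fun h => hx' ⟨h, hx⟩⟩
      · exact Or.inr ⟨hx, hx'⟩
    -- Clamping the grid points to `[u, v]` makes `hcell` hold for every cell: those missing `A`
    -- collapse to a point.
    set c : ℝ → ℝ := fun x => max u (min v x) with hcdef
    have hcm : Monotone c := fun x y hxy => max_le_max le_rfl (min_le_min le_rfl hxy)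
    have hcell : ∀ k, m (I k ∩ A) = f (c (r * (k + 1 : ℤ))) - f (c (r * k)) := by
      intro k
      have hk : r * (k : ℝ) ≤ r * (k + 1 : ℤ) := by push_cast; nlinarith
      simp only [hI, hA, hcdef]
      generalize r * (k : ℝ) = x at *
      generalize r * ((k + 1 : ℤ) : ℝ) = y at *
      rw [Ico_inter_Ico]
      rcases le_or_gt (max x u) (min y v) with h | h
      · rw [hmI h]
        congr 2 <;> grind
      · rw [Ico_eq_empty h.not_gt, VectorMeasure.empty]
        have : max u (min v x) = max u (min v y) := by grind
        rw [this, sub_self]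
    obtain ⟨N, hNu, hNv, hNs⟩ : ∃ N : ℕ, r * (-N : ℤ) ≤ u ∧ v ≤ r * N ∧
        ∀ k ∈ s, -(N : ℤ) ≤ k ∧ k < N := by
      obtain ⟨N₁, h1⟩ := exists_nat_ge (-u / r)
      obtain ⟨N₂, h2⟩ := exists_nat_ge (v / r)
      rw [div_le_iff₀' hr] at h1 h2
      obtain ⟨M, hM⟩ : ∃ M : ℕ, ∀ k ∈ s, k.natAbs ≤ M :=
        ⟨∑ k ∈ s, k.natAbs, fun k hk => Finset.single_le_sum (f := fun k : ℤ => k.natAbs)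
          (fun _ _ => Nat.zero_le _) hk⟩
      refine ⟨N₁ + N₂ + M + 1, ?_, ?_, fun k hk => ?_⟩
      · push_cast
        have : (0 : ℝ) ≤ N₂ + M + 1 := by positivity
        nlinarith
      · push_cast
        have : (0 : ℝ) ≤ N₁ + M + 1 := by positivity
        nlinarith
      · have := hM k hk
        omega
    set s' : Finset ℤ := (Finset.range (2 * N)).image (fun i : ℕ => (i : ℤ) - N) with hs'
    have hmem : ∀ k : ℤ, -(N : ℤ) ≤ k → k < N → k ∈ s' := fun k h1 h2 => by
      simp only [hs', Finset.mem_image, Finset.mem_range]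
      exact ⟨(k + N).toNat, by omega, by omega⟩
    have hss' : s ⊆ s' := fun k hk => hmem k (hNs k hk).1 (hNs k hk).2
    have hsum : ∀ t : Finset ℤ, m ((⋃ k ∈ t, I k) ∩ A) = ∑ k ∈ t, m (I k ∩ A) := fun t => by
      rw [iUnion₂_inter]
      exact VectorMeasure.of_biUnion_finset
        (fun i _ j _ hij => ((pairwise_disjoint_grid hr hij).mono inter_subset_left
          inter_subset_left)) fun _ _ => measurableSet_Ico.inter hAm
    have hcover : (⋃ k ∈ s', I k) ∩ A = A := by
      refine inter_eq_right.2 fun x hx => ?_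
      have h1 := Int.floor_le (x / r)
      have h2 := Int.lt_floor_add_one (x / r)
      rw [le_div_iff₀' hr] at h1
      rw [div_lt_iff₀' hr] at h2
      refine mem_iUnion₂.2 ⟨⌊x / r⌋, hmem _ ?_ ?_, h1, by push_cast; exact h2⟩
      · rw [Int.le_floor, le_div_iff₀' hr]
        exact hNu.trans hx.1
      · rw [Int.floor_lt, div_lt_iff₀' hr]
        exact hx.2.trans_le (by exact_mod_cast hNv)
    -- The left side is the sum of `± m (I k ∩ A)` over all cells, with sign `+` exactly for `k ∈
    -- s`. It is bounded by a variation sum of `f` along the clamped grid.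
    have hmain : 2 * m (T ∩ A) - m A ≤ (eVariationOn f (Icc u v)).toReal := by
      calc 2 * m (T ∩ A) - m A
          = ∑ k ∈ s', (2 * (if k ∈ s then m (I k ∩ A) else 0) - m (I k ∩ A)) := by
            rw [Finset.sum_sub_distrib, ← Finset.mul_sum, ← hsum s', hcover, hT, hsum s,
              ← Finset.sum_filter, Finset.filter_mem_eq_inter, Finset.inter_eq_right.2 hss']
        _ ≤ ∑ k ∈ s', |m (I k ∩ A)| := by
            refine Finset.sum_le_sum fun k _ => ?_
            split_ifs
            · linarith [le_abs_self (m (I k ∩ A))]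
            · linarith [neg_abs_le (m (I k ∩ A))]
        _ = ∑ i ∈ Finset.range (2 * N), |f (c (r * (((i + 1 : ℕ) : ℤ) - N : ℤ))) -
              f (c (r * ((i : ℤ) - N : ℤ)))| := by
            rw [hs', Finset.sum_image fun i _ j _ h => by simpa using h]
            refine Finset.sum_congr rfl fun i _ => ?_
            rw [hcell]
            congr 6
            push_cast
            ring
        _ ≤ (eVariationOn f (Icc u v)).toReal := by
            have hxm : Monotone (fun i : ℕ => c (r * ((i : ℤ) - N : ℤ))) := fun i j hij =>
              hcm (mul_le_mul_of_nonneg_left (Int.cast_le.2 (by omega)) hr.le)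
            have := eVariationOn.sum_le (f := f) (n := 2 * N) hxm (s := Icc u v)
              fun i => ⟨le_max_left _ _, max_le huv (min_le_left _ _)⟩
            refine le_trans (le_of_eq ?_) (ENNReal.toReal_mono hfin this)
            rw [ENNReal.toReal_sum fun _ _ => edist_ne_top _ _]
            refine Finset.sum_congr rfl fun i _ => ?_
            rw [← dist_edist, Real.dist_eq]
    rw [htv]
    linarith [(abs_le.1 happ).2]
  · refine iSup_le ?_
    rintro ⟨n, x, hx, hxs⟩
    calc ∑ i ∈ Finset.range n, edist (f (x (i + 1))) (f (x i))
        = ∑ i ∈ Finset.range n, ‖m (Ico (x i) (x (i + 1)))‖ₑ := by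
          refine Finset.sum_congr rfl fun i _ => ?_
          rw [hmI (hx i.le_succ), edist_eq_enorm_sub]
      _ ≤ ∑ i ∈ Finset.range n, m.totalVariation (Ico (x i) (x (i + 1))) :=
          Finset.sum_le_sum fun i _ => m.enorm_le_totalVariation _
      _ = m.totalVariation (⋃ i ∈ Finset.range n, Ico (x i) (x (i + 1))) :=
          (measure_biUnion_finset (fun i _ j _ hij => hx.pairwise_disjoint_on_Ico_succ hij)
            fun _ _ => measurableSet_Ico).symm
      _ ≤ m.totalVariation (Ico u v) := by
          refine measure_mono (iUnion₂_subset fun i _ => Ico_subset_Ico (hxs i).1 (hxs (i + 1)).2)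

/-! ### One-sided limits of indefinite integrals and distribution functions -/

/-- As `s` decreases to `t` the indicators of `Iio s` converge to that of `Iic t`, so the limit
picks up the atom at `t`; the limit from the left does not. -/
theorem tendsto_setIntegral_Iio_right (ν : Measure ℝ) {φ : ℝ → ℝ}
    (hφ : Integrable φ ν) (t : ℝ) :
    Tendsto (fun s => ∫ x in Iio s, φ x ∂ν) (𝓝[>] t) (𝓝 (∫ x in Iic t, φ x ∂ν)) := by
  simp_rw [← integral_indicator measurableSet_Iio, ← integral_indicator measurableSet_Iic]
  refine tendsto_integral_filter_of_dominated_convergence (fun x => ‖φ x‖)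
    (Eventually.of_forall fun s => (hφ.indicator measurableSet_Iio).aestronglyMeasurable)
    (Eventually.of_forall fun s => Eventually.of_forall fun x => norm_indicator_le_norm_self _ _)
    hφ.norm (Eventually.of_forall fun x => ?_)
  refine tendsto_const_nhds.congr' ?_
  rcases le_or_gt x t with h | h
  · filter_upwards [self_mem_nhdsWithin] with s hs
    rw [indicator_of_mem (mem_Iic.2 h), indicator_of_mem (mem_Iio.2 (h.trans_lt hs))]
  · filter_upwards [Ioo_mem_nhdsGT h] with s hs
    rw [indicator_of_notMem (by simpa using h), indicator_of_notMem (by simpa using hs.2.le)]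

theorem tendsto_setIntegral_Iio_left (ν : Measure ℝ) {φ : ℝ → ℝ}
    (hφ : Integrable φ ν) (t : ℝ) :
    Tendsto (fun s => ∫ x in Iio s, φ x ∂ν) (𝓝[<] t) (𝓝 (∫ x in Iio t, φ x ∂ν)) := by
  simp_rw [← integral_indicator measurableSet_Iio]
  refine tendsto_integral_filter_of_dominated_convergence (fun x => ‖φ x‖)
    (Eventually.of_forall fun s => (hφ.indicator measurableSet_Iio).aestronglyMeasurable)
    (Eventually.of_forall fun s => Eventually.of_forall fun x => norm_indicator_le_norm_self _ _)
    hφ.norm (Eventually.of_forall fun x => ?_)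
  refine tendsto_const_nhds.congr' ?_
  rcases le_or_gt t x with h | h
  · filter_upwards [self_mem_nhdsWithin] with s hs
    rw [indicator_of_notMem (by simpa using h),
      indicator_of_notMem (by simpa using (mem_Iio.1 hs).le.trans h)]
  · filter_upwards [Ioo_mem_nhdsLT h] with s hs
    rw [indicator_of_mem (mem_Iio.2 h), indicator_of_mem (mem_Iio.2 hs.1)]

section FiniteMeasure

variable (ν : Measure ℝ) [IsFiniteMeasure ν]

theorem tendsto_measureReal_Iio_right (t : ℝ) :
    Tendsto (fun s => ν.real (Iio s)) (𝓝[>] t) (𝓝 (ν.real (Iic t))) := by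
  simpa using tendsto_setIntegral_Iio_right ν (integrable_const (1 : ℝ)) t

theorem tendsto_measureReal_Iio_left (t : ℝ) :
    Tendsto (fun s => ν.real (Iio s)) (𝓝[<] t) (𝓝 (ν.real (Iio t))) := by
  simpa using tendsto_setIntegral_Iio_left ν (integrable_const (1 : ℝ)) t

theorem measureReal_Iic_eq_add (t : ℝ) : ν.real (Iic t) = ν.real (Iio t) + ν.real {t} := by
  rw [← Iio_union_right, measureReal_union (by simp) (measurableSet_singleton t)]

theorem monotone_measureReal_Iio : Monotone (fun s => ν.real (Iio s)) := fun _ _ h =>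
  measureReal_mono (Iio_subset_Iio h)

theorem continuousAt_measureReal_Iio {t : ℝ} (ht : ν {t} = 0) :
    ContinuousAt (fun s => ν.real (Iio s)) t := by
  rw [continuousAt_iff_continuous_left'_right']
  refine ⟨tendsto_measureReal_Iio_left ν t, ?_⟩
  have h := tendsto_measureReal_Iio_right ν t
  rwa [measureReal_Iic_eq_add, measureReal_def ν {t}, ht, ENNReal.toReal_zero, add_zero] at h

/-! ### Quantile transport of Lebesgue measure -/

/-- The right-continuous inverse of the distribution function `t ↦ ν (-∞, t)`. -/
noncomputable def quantile (x : ℝ) : ℝ := sSup {s | ν.real (Iio s) ≤ x}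

theorem tendsto_measureReal_Iio_atBot :
    Tendsto (fun s => ν.real (Iio s)) atBot (𝓝 0) := by
  have h : Tendsto (fun s : ℝ => ∫ x, (Iio s).indicator (fun _ => (1 : ℝ)) x ∂ν) atBot
      (𝓝 (∫ _, (0 : ℝ) ∂ν)) := by
    refine tendsto_integral_filter_of_dominated_convergence (fun _ => (1 : ℝ))
      (Eventually.of_forall fun s =>
        ((integrable_const (1 : ℝ)).indicator measurableSet_Iio).aestronglyMeasurable)
      (Eventually.of_forall fun s => Eventually.of_forall fun x =>
        (norm_indicator_le_norm_self _ _).trans (by simp))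
      (integrable_const 1) (Eventually.of_forall fun x => tendsto_const_nhds.congr' ?_)
    filter_upwards [eventually_le_atBot x] with s hs
    rw [indicator_of_notMem (by simpa using hs)]
  simpa [integral_indicator measurableSet_Iio] using h

theorem tendsto_measureReal_Iio_atTop :
    Tendsto (fun s => ν.real (Iio s)) atTop (𝓝 (ν.real univ)) := by
  have h : Tendsto (fun s : ℝ => ∫ x, (Iio s).indicator (fun _ => (1 : ℝ)) x ∂ν) atTop
      (𝓝 (∫ _, (1 : ℝ) ∂ν)) := by
    refine tendsto_integral_filter_of_dominated_convergence (fun _ => (1 : ℝ))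
      (Eventually.of_forall fun s =>
        ((integrable_const (1 : ℝ)).indicator measurableSet_Iio).aestronglyMeasurable)
      (Eventually.of_forall fun s => Eventually.of_forall fun x =>
        (norm_indicator_le_norm_self _ _).trans (by simp))
      (integrable_const 1) (Eventually.of_forall fun x => tendsto_const_nhds.congr' ?_)
    filter_upwards [eventually_gt_atTop x] with s hs
    rw [indicator_of_mem (mem_Iio.2 hs)]
  simpa [integral_indicator measurableSet_Iio] using h

/-- The range of `x` makes the set defining the quantile nonempty and bounded above. Left-continuity
of the distribution function gives the strict inequality from right to left. -/
theorem quantile_lt_iff {x : ℝ} (hx : x ∈ Ioo 0 (ν.real univ)) (t : ℝ) :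
    quantile ν x < t ↔ x < ν.real (Iio t) := by
  have hne : {s | ν.real (Iio s) ≤ x}.Nonempty :=
    (((tendsto_measureReal_Iio_atBot ν).eventually_lt_const hx.1).exists).imp fun _ h => le_of_lt h
  have hbdd : BddAbove {s | ν.real (Iio s) ≤ x} := by
    obtain ⟨y, hy⟩ := ((tendsto_measureReal_Iio_atTop ν).eventually_const_lt hx.2).exists
    refine ⟨y, fun s hs => le_of_not_gt fun h => ?_⟩
    exact absurd (hy.trans_le (monotone_measureReal_Iio ν h.le)) (not_lt.2 hs)
  constructor
  · intro h
    by_contra! h'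
    exact absurd (le_csSup hbdd h') (not_le.2 h)
  · intro h
    obtain ⟨s, hs, hst⟩ := (((tendsto_measureReal_Iio_left ν t).eventually_const_lt h).and
      self_mem_nhdsWithin).exists
    refine (csSup_le hne fun y hy => le_of_not_gt fun hsy => ?_).trans_lt hst
    exact absurd (hs.trans_le (monotone_measureReal_Iio ν hsy.le)) (not_lt.2 hy)

/-- In general `x` lies between the masses of `Iio` and `Iic` at its quantile; without an atom there
the two agree. -/
theorem measureReal_Iio_quantile {x : ℝ} (hx : x ∈ Ioo 0 (ν.real univ))
    (h0 : ν {quantile ν x} = 0) : ν.real (Iio (quantile ν x)) = x := by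
  apply le_antisymm (not_lt.1 fun h => lt_irrefl _ ((quantile_lt_iff ν hx _).2 h))
  have h := (continuousAt_measureReal_Iio ν h0).mono_left (nhdsWithin_le_nhds (s := Ioi (quantile ν x)))
  refine ge_of_tendsto h ?_
  filter_upwards [self_mem_nhdsWithin] with s hs
  exact ((quantile_lt_iff ν hx s).1 hs).le

theorem aemeasurable_quantile :
    AEMeasurable (quantile ν) (volume.restrict (Ioo 0 (ν.real univ))) := by
  refine aemeasurable_restrict_of_monotoneOn measurableSet_Ioo fun x hx y hy hxy => ?_
  refine le_of_not_gt fun h => ?_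
  have := (quantile_lt_iff ν hy _).1 h
  exact lt_irrefl _ ((quantile_lt_iff ν hx _).2 (hxy.trans_lt this))

theorem quantile_preimage_Iio (t : ℝ) :
    quantile ν ⁻¹' Iio t ∩ Ioo 0 (ν.real univ) = Ioo 0 (ν.real (Iio t)) := by
  ext x
  constructor
  · rintro ⟨h, hx⟩
    exact ⟨hx.1, (quantile_lt_iff ν hx t).1 h⟩
  · rintro ⟨h0, h⟩
    have hx : x ∈ Ioo 0 (ν.real univ) := ⟨h0, h.trans_le (measureReal_mono (subset_univ _))⟩
    exact ⟨(quantile_lt_iff ν hx t).2 h, hx⟩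

/-- The quantile function transports Lebesgue measure to `ν`. -/
theorem map_quantile :
    Measure.map (quantile ν) (volume.restrict (Ioo 0 (ν.real univ))) = ν := by
  have hlt : ∀ t, Measure.map (quantile ν) (volume.restrict (Ioo 0 (ν.real univ))) (Iio t) =
      ν (Iio t) := fun t => by
    rw [Measure.map_apply_of_aemeasurable (aemeasurable_quantile ν) measurableSet_Iio,
      Measure.restrict_apply' measurableSet_Ioo, quantile_preimage_Iio, Real.volume_Ioo, sub_zero,
      ofReal_measureReal]
  have huniv : Measure.map (quantile ν) (volume.restrict (Ioo 0 (ν.real univ))) univ = ν univ := by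
    rw [Measure.map_apply_of_aemeasurable (aemeasurable_quantile ν) MeasurableSet.univ]
    simp
  have : IsFiniteMeasure (Measure.map (quantile ν) (volume.restrict (Ioo 0 (ν.real univ)))) :=
    ⟨by rw [huniv]; exact measure_lt_top _ _⟩
  refine Measure.ext_of_Ici _ _ fun t => ?_
  rw [← compl_Iio, measure_compl measurableSet_Iio (measure_ne_top _ _),
    measure_compl measurableSet_Iio (measure_ne_top _ _), hlt, huniv]

/-- Change of variables along the quantile, whose preimage of `Iio t` is `Ioo 0 (ν.real (Iio t))`.
The indicator discards arguments at which the quantile is uncontrolled. -/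
theorem setIntegral_Iio_eq_intervalIntegral {φ : ℝ → ℝ} (hφ : Integrable φ ν) (t : ℝ) :
    ∫ x in Iio t, φ x ∂ν = ∫ y in (0 : ℝ)..ν.real (Iio t),
      (Ioo 0 (ν.real univ)).indicator (fun y => φ (quantile ν y)) y := by
  rw [intervalIntegral.integral_of_le measureReal_nonneg,
    integral_Ioc_eq_integral_Ioo, setIntegral_indicator measurableSet_Ioo]
  have h1 : Ioo 0 (ν.real (Iio t)) ∩ Ioo 0 (ν.real univ) = Ioo 0 (ν.real (Iio t)) := by
    rw [← quantile_preimage_Iio, inter_assoc, inter_self]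
  have hq := map_quantile ν
  rw [h1, ← quantile_preimage_Iio]
  conv_lhs => rw [← hq]
  rw [← integral_indicator measurableSet_Iio, integral_map (aemeasurable_quantile ν)
    (by rw [hq]; exact (hφ.indicator measurableSet_Iio).aestronglyMeasurable)]
  rw [← integral_indicator measurableSet_Ioo, ← integral_indicator (by
    rw [quantile_preimage_Iio]; exact measurableSet_Ioo)]
  congr 1
  ext y
  simp only [indicator, mem_inter_iff, mem_preimage]
  split_ifs <;> simp_all

/-! ### Differentiation of indefinite integrals -/

/-- Differentiation of an indefinite integral with respect to a finite measure on the line, at the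
points that are not atoms. -/
theorem ae_isLittleO_setIntegral_Iio {φ : ℝ → ℝ} (hφ : Integrable φ ν) :
    ∀ᵐ t ∂ν, ν {t} = 0 →
      (fun s => ∫ x in Iio s, φ x ∂ν - ∫ x in Iio t, φ x ∂ν -
        φ t * (ν.real (Iio s) - ν.real (Iio t))) =o[𝓝 t]
      (fun s => ν.real (Iio s) - ν.real (Iio t)) := by
  set M := ν.real univ with hM
  set Ψ : ℝ → ℝ := (Ioo 0 M).indicator (fun y => φ (quantile ν y)) with hΨ
  have hΨi : Integrable Ψ := by
    rw [hΨ, integrable_indicator_iff measurableSet_Ioo]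
    have := (map_quantile ν).symm ▸ hφ
    exact this.comp_aemeasurable (aemeasurable_quantile ν)
  -- A Borel version of the quantile and, below, a Borel null set `B` containing the bad points make
  -- the condition in `hQ` measurable, as the transfer through `map_quantile` requires.
  set τ : ℝ → ℝ := (aemeasurable_quantile ν).mk _ with hτ
  set Γ : ℝ → ℝ := fun s => ν.real (Iio s) with hΓ
  have hgood : ∀ᵐ y, (∀ c, HasDerivAt (fun x => ∫ z in c..x, Ψ z) (Ψ y) y) ∧
      (y ∈ Ioo 0 M → quantile ν y = τ y) :=
    (LocallyIntegrable.ae_hasDerivAt_integral hΨi.locallyIntegrable).and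
      ((ae_restrict_iff' measurableSet_Ioo).1 (aemeasurable_quantile ν).ae_eq_mk)
  obtain ⟨B, hBsub, hBm, hB⟩ := exists_measurable_superset_of_null (ae_iff.1 hgood)
  replace hBsub : ∀ y ∉ B, (∀ c, HasDerivAt (fun x => ∫ z in c..x, Ψ z) (Ψ y) y) ∧
      (y ∈ Ioo 0 M → quantile ν y = τ y) := fun y hy => by
    by_contra h
    exact hy (hBsub h)
  have hΓm : Measurable Γ := (monotone_measureReal_Iio ν).measurable
  have hatom : MeasurableSet {t : ℝ | ν {t} = 0} := by
    have : {t : ℝ | 0 < ν {t}}.Countable :=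
      Measure.countable_meas_pos_of_disjoint_iUnion (fun t => measurableSet_singleton t)
        fun i j hij => by simpa [Function.onFun] using hij
    convert this.measurableSet.compl using 1
    ext t
    simp
  have hQ : ∀ᵐ t ∂ν, ν {t} = 0 → Γ t ∈ Ioo 0 M ∧ Γ t ∉ B ∧ τ (Γ t) = t := by
    have hmeas : MeasurableSet {t | ν {t} = 0 → Γ t ∈ Ioo 0 M ∧ Γ t ∉ B ∧ τ (Γ t) = t} := by
      have h1 : MeasurableSet {t | Γ t ∈ Ioo 0 M} := hΓm measurableSet_Ioo
      have h2 : MeasurableSet {t | Γ t ∉ B} := hΓm hBm.compl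
      have h3 : MeasurableSet {t | τ (Γ t) = t} :=
        measurableSet_eq_fun ((aemeasurable_quantile ν).measurable_mk.comp hΓm) measurable_id
      exact hatom.imp (h1.inter (h2.inter h3))
    have hq : ∀ p : ℝ → Prop, MeasurableSet {t | p t} →
        (∀ᵐ x ∂volume.restrict (Ioo 0 M), p (quantile ν x)) → ∀ᵐ t ∂ν, p t := fun p hp h => by
      have := (ae_map_iff (aemeasurable_quantile ν) hp).2 h
      rwa [map_quantile ν] at this
    refine hq _ hmeas ?_
    have hBae : ∀ᵐ x ∂volume.restrict (Ioo 0 M), x ∉ B :=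
      ae_restrict_of_ae (measure_eq_zero_iff_ae_notMem.1 hB)
    filter_upwards [hBae, ae_restrict_mem measurableSet_Ioo] with x hxB hx h0
    have hx' : Γ (quantile ν x) = x := measureReal_Iio_quantile ν hx h0
    rw [hx']
    exact ⟨hx, hxB, ((hBsub x hxB).2 hx).symm⟩
  filter_upwards [hQ] with t ht h0
  obtain ⟨hΓt, hΓB, hqt⟩ := ht h0
  have hder : HasDerivAt (fun y => ∫ z in (0 : ℝ)..y, Ψ z) (Ψ (Γ t)) (Γ t) :=
    (hBsub _ hΓB).1 0
  have hval : Ψ (Γ t) = φ t := by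
    rw [hΨ, indicator_of_mem hΓt, (hBsub _ hΓB).2 hΓt, hqt]
  -- Composing the little-o form of the derivative with `Γ`, which is continuous at `t`, avoids any
  -- division where `Γ` is flat.
  have h := hder.isLittleO.comp_tendsto (continuousAt_measureReal_Iio ν h0)
  rw [hval] at h
  refine h.congr_left fun s => ?_
  simp only [Function.comp, hΓ, smul_eq_mul, setIntegral_Iio_eq_intervalIntegral ν hφ]
  ring

/-- Differentiation of an indefinite integral with respect to a finite measure on the line, at an
atom. -/
theorem isLittleO_setIntegral_Iio_of_atom {φ : ℝ → ℝ} (hφ : Integrable φ ν) {t : ℝ}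
    (ht : ν {t} ≠ 0) :
    (fun s => ∫ x in Iio s, φ x ∂ν - ∫ x in Iio t, φ x ∂ν -
        φ t * (ν.real (Iio s) - ν.real (Iio t))) =o[𝓝[>] t]
      (fun s => ν.real (Iio s) - ν.real (Iio t)) := by
  -- The increment of `Γ` tends to the nonzero mass of the atom, so it suffices that the numerator
  -- tends to `0`.
  have hd : Tendsto (fun s => ν.real (Iio s) - ν.real (Iio t)) (𝓝[>] t) (𝓝 (ν.real {t})) := by
    have := (tendsto_measureReal_Iio_right ν t).sub_const (ν.real (Iio t))
    rwa [measureReal_Iic_eq_add, add_sub_cancel_left] at this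
  have hpos : ν.real {t} ≠ 0 := by
    simpa [measureReal_def, ENNReal.toReal_eq_zero_iff] using ht
  have hI : ∫ x in Iic t, φ x ∂ν = ∫ x in Iio t, φ x ∂ν + φ t * ν.real {t} := by
    rw [← Iio_union_right, setIntegral_union (by simp) (measurableSet_singleton t)
      hφ.integrableOn hφ.integrableOn]
    simp [mul_comm, measureReal_def]
  have hn : Tendsto (fun s => ∫ x in Iio s, φ x ∂ν - ∫ x in Iio t, φ x ∂ν -
        φ t * (ν.real (Iio s) - ν.real (Iio t))) (𝓝[>] t) (𝓝 0) := by
    have := ((tendsto_setIntegral_Iio_right ν hφ t).sub_const (∫ x in Iio t, φ x ∂ν)).sub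
      (hd.const_mul (φ t))
    rwa [hI, add_sub_cancel_left, sub_self] at this
  refine ((isLittleO_one_iff ℝ).2 hn).trans_isBigO ?_
  exact (isBigO_const_const (1 : ℝ) hpos _).trans
    ((isEquivalent_const_iff_tendsto hpos).2 hd).isBigO_symm

end FiniteMeasure

/-! ### The measure of a derivator and its variation function -/

theorem continuousWithinAt_clamp {f : ℝ → ℝ} {a b : ℝ} (hab : a ≤ b)
    (hf : ∀ t ∈ Icc a b, ContinuousWithinAt f (Icc a b ∩ Iic t) t) (t : ℝ) :
    ContinuousWithinAt (clamp f a b) (Iic t) t := by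
  have hc : Continuous fun s : ℝ => max a (min b s) := by fun_prop
  have hmem : ∀ s : ℝ, max a (min b s) ∈ Icc a b := fun s =>
    ⟨le_max_left _ _, max_le hab (min_le_left _ _)⟩
  exact ContinuousWithinAt.comp (f := fun s : ℝ => max a (min b s)) (hf _ (hmem t))
    hc.continuousWithinAt fun s hs =>
      ⟨hmem s, mem_Iic.2 (max_le_max le_rfl (min_le_min le_rfl hs))⟩

theorem clamp_of_mem {f : ℝ → ℝ} {a b t : ℝ} (ht : t ∈ Icc a b) : clamp f a b t = f t := by
  rw [clamp, min_eq_right ht.2, max_eq_right ht.1]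

instance IsDerivator.isFiniteMeasure_absMeasure {g : ℝ → ℝ} (hg : IsDerivator g) (a b : ℝ) :
    IsFiniteMeasure (hg.absMeasure a b) := by
  unfold IsDerivator.absMeasure
  infer_instance

theorem IsDerivator.clamp_leftCont {g : ℝ → ℝ} (hg : IsDerivator g) {a b : ℝ}
    (hab : a ≤ b) (t : ℝ) :
    ContinuousWithinAt (clamp g a b) (Iic t) t :=
  continuousWithinAt_clamp hab (fun t _ => (hg.leftCont t).mono inter_subset_right) t

theorem IsDerivator.signedMeasure_Ico {g : ℝ → ℝ} (hg : IsDerivator g) {a b : ℝ}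
    (hab : a ≤ b) {u v : ℝ} (huv : u ≤ v) :
    hg.signedMeasure a b (Ico u v) = clamp g a b v - clamp g a b u :=
  vectorMeasure_Ico_of_leftCont (hg.clamp_bv a b) (hg.clamp_leftCont hab) huv

theorem IsDerivator.absMeasure_Ico_eq {g : ℝ → ℝ} (hg : IsDerivator g) {a b : ℝ}
    (hab : a ≤ b) {u v : ℝ} (huv : u ≤ v) :
    hg.absMeasure a b (Ico u v) = eVariationOn (clamp g a b) (Icc u v) :=
  totalVariation_Ico_of_leftCont (hg.clamp_bv a b) (hg.clamp_leftCont hab) huv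

theorem IsDerivator.absMeasure_real_Ico {g : ℝ → ℝ} (hg : IsDerivator g) {a b : ℝ}
    {u v : ℝ} (hau : a ≤ u) (huv : u ≤ v) (hvb : v ≤ b) :
    (hg.absMeasure a b).real (Ico u v) = totalVar g u v := by
  rw [measureReal_def, hg.absMeasure_Ico_eq (hau.trans (huv.trans hvb)) huv, totalVar,
    eVariationOn.eq_of_eqOn fun t ht => clamp_of_mem ⟨hau.trans ht.1, ht.2.trans hvb⟩]

theorem IsDerivator.absMeasure_Iio {g : ℝ → ℝ} (hg : IsDerivator g) {a b : ℝ}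
    (hab : a ≤ b) : hg.absMeasure a b (Iio a) = 0 := by
  have h : Iio a ⊆ ⋃ n : ℕ, Ico (a - n) a := fun x hx => by
    obtain ⟨n, hn⟩ := exists_nat_ge (a - x)
    exact mem_iUnion.2 ⟨n, by linarith, hx⟩
  refine measure_mono_null h (measure_iUnion_null fun n => ?_)
  rw [hg.absMeasure_Ico_eq hab (by simp)]
  refine eVariationOn.constant_on ?_
  rintro _ ⟨x, hx, rfl⟩ _ ⟨y, hy, rfl⟩
  simp only [clamp]
  rw [min_eq_right (hx.2.trans hab), min_eq_right (hy.2.trans hab), max_eq_left hx.2,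
    max_eq_left hy.2]

/-- The clamped function is constant on `[b, ∞)`, so a jump of `g` at `b` leaves no mass there. -/
theorem IsDerivator.absMeasure_Ici {g : ℝ → ℝ} (hg : IsDerivator g) {a b : ℝ}
    (hab : a ≤ b) : hg.absMeasure a b (Ici b) = 0 := by
  have h : Ici b ⊆ ⋃ n : ℕ, Ico b (b + n) := fun x hx => by
    obtain ⟨n, hn⟩ := exists_nat_gt (x - b)
    exact mem_iUnion.2 ⟨n, hx, by linarith⟩
  refine measure_mono_null h (measure_iUnion_null fun n => ?_)
  rw [hg.absMeasure_Ico_eq hab (by simp)]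
  refine eVariationOn.constant_on ?_
  rintro _ ⟨x, hx, rfl⟩ _ ⟨y, hy, rfl⟩
  simp only [clamp]
  rw [min_eq_left hx.1, min_eq_left hy.1]

theorem IsDerivator.varFun_sub {g : ℝ → ℝ} (hg : IsDerivator g)
    {s t : ℝ} (hst : s ≤ t) :
    varFun g t - varFun g s = totalVar g s t := by
  have h : ∀ t, varFun g t = g 0 + variationOnFromTo g univ 0 t := fun t => by
    rw [varFun, variationOnFromTo]
    split_ifs <;> simp [totalVar, sub_eq_add_neg]
  have := variationOnFromTo.sub_right hg.locallyBV (mem_univ 0) (mem_univ t) (mem_univ s)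
  rw [h, h, add_sub_add_left_eq_sub, this, variationOnFromTo.eq_of_le _ _ hst, totalVar, univ_inter]

/-- This is the bridge between measure-theoretic facts about `|μ_g|` and the sets `C_g`, `D_g`,
which are defined through the variation function. -/
theorem IsDerivator.absMeasure_real_Iio_sub {g : ℝ → ℝ} (hg : IsDerivator g) {a b : ℝ}
    {s t : ℝ} (hs : s ∈ Icc a b) (ht : t ∈ Icc a b) :
    (hg.absMeasure a b).real (Iio t) - (hg.absMeasure a b).real (Iio s) =
      varFun g t - varFun g s := by
  wlog hst : s ≤ t generalizing s t
  · rw [← neg_sub, this ht hs (le_of_not_ge hst), neg_sub]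
  rw [hg.varFun_sub hst, ← hg.absMeasure_real_Ico hs.1 hst ht.2, ← Iio_union_Ico_eq_Iio hst,
    measureReal_union _ measurableSet_Ico, add_sub_cancel_left]
  exact disjoint_left.2 fun x hx hx' => absurd hx'.1 (not_le.2 hx)

theorem IsDerivator.setIntegral_Iio_eq_Ico {g : ℝ → ℝ} (hg : IsDerivator g) {a b t : ℝ}
    (ht : t ∈ Icc a b) (f : ℝ → ℝ) :
    ∫ x in Iio t, f x ∂(hg.absMeasure a b) = ∫ x in Ico a t, f x ∂(hg.absMeasure a b) := by
  refine setIntegral_congr_set ?_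
  rw [← Iio_union_Ico_eq_Iio ht.1]
  exact union_ae_eq_right_of_ae_eq_empty
    (ae_eq_empty.2 (hg.absMeasure_Iio (ht.1.trans ht.2)))

/-- The sign density of `μ_g` with respect to `|μ_g|`. -/
theorem IsDerivator.exists_sign_density {g : ℝ → ℝ} (hg : IsDerivator g) {a b : ℝ}
    (hab : a ≤ b) :
    ∃ ψ : ℝ → ℝ, Measurable ψ ∧ (∀ x, ψ x = 1 ∨ ψ x = -1) ∧
      (∀ E f, MeasurableSet E → IntegrableOn f E (hg.absMeasure a b) →
        hg.integral a b E f = ∫ x in E, f x * ψ x ∂(hg.absMeasure a b)) ∧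
      ∀ t ∈ Icc a b, g t - g a = ∫ x in Iio t, ψ x ∂(hg.absMeasure a b) := by
  classical
  obtain ⟨S, hS, hp, hn⟩ := exists_jordan_eq_restrict (hg.signedMeasure a b)
  set ν := hg.absMeasure a b with hν
  set ψ : ℝ → ℝ := fun x => if x ∈ S then -1 else 1 with hψ
  have hψm : Measurable ψ := Measurable.ite hS measurable_const measurable_const
  have hψ1 : ∀ x, ψ x = 1 ∨ ψ x = -1 := fun x => by
    by_cases h : x ∈ S <;> simp [hψ, h]
  have hint : ∀ E f, MeasurableSet E → IntegrableOn f E ν →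
      hg.integral a b E f = ∫ x in E, f x * ψ x ∂ν := by
    intro E f hE hf
    have hfψ : IntegrableOn (fun x => f x * ψ x) E ν :=
      Integrable.mul_bdd (c := 1) hf hψm.aestronglyMeasurable (Eventually.of_forall fun x => by
        rcases hψ1 x with h | h <;> simp [h])
    have h1 : ∫ x in E ∩ S, f x * ψ x ∂ν = -∫ x in E ∩ S, f x ∂ν := by
      rw [← integral_neg]
      exact setIntegral_congr_fun (hE.inter hS) fun x hx => by simp [hψ, hx.2]
    have h2 : ∫ x in E \ S, f x * ψ x ∂ν = ∫ x in E \ S, f x ∂ν :=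
      setIntegral_congr_fun (hE.diff hS) fun x hx => by simp [hψ, hx.2]
    rw [IsDerivator.integral, hp, hn, Measure.restrict_restrict hE, Measure.restrict_restrict hE,
      ← integral_inter_add_sdiff hS hfψ, h1, h2, Set.sdiff_eq]
    exact sub_eq_neg_add _ _
  refine ⟨ψ, hψm, hψ1, hint, fun t ht => ?_⟩
  have h1 := hint (Ico a t) (fun _ => 1) measurableSet_Ico (integrable_const _)
  have h2 : hg.integral a b (Ico a t) (fun _ => 1) = hg.signedMeasure a b (Ico a t) := by
    rw [SignedMeasure.apply_eq_posPart_real_sub_negPart_real _ measurableSet_Ico,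
      IsDerivator.integral]
    simp
  rw [hg.signedMeasure_Ico hab ht.1, clamp_of_mem ht, clamp_of_mem ⟨le_rfl, hab⟩] at h2
  rw [← h2, h1]
  simp only [one_mul]
  exact (hg.setIntegral_Iio_eq_Ico ht ψ).symm

/-! ### Consequences of `g`-absolute continuity: bounded variation and a density -/

/-- In the definition of `g`-absolute continuity the intervals may be degenerate and indexed by
any finite set. -/
theorem GAbsolutelyContinuousOn.exists_finset {g F : ℝ → ℝ} {a b : ℝ}
    (hF : GAbsolutelyContinuousOn g a b F) {ε : ℝ} (hε : 0 < ε) :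
    ∃ δ > 0, ∀ {ι : Type} (s : Finset ι) (u v : ι → ℝ),
      (∀ i ∈ s, a ≤ u i ∧ u i ≤ v i ∧ v i ≤ b) →
      (s : Set ι).Pairwise (fun i j => Disjoint (Ioo (u i) (v i)) (Ioo (u j) (v j))) →
      ∑ i ∈ s, totalVar g (u i) (v i) < δ → ∑ i ∈ s, |F (v i) - F (u i)| < ε := by
  classical
  obtain ⟨δ, hδ, h⟩ := hF ε hε
  refine ⟨δ, hδ, fun {ι} s u v hs hd hsum => ?_⟩
  set s' := s.filter (fun i => u i < v i) with hs'
  let e : Fin s'.card ≃ s' := s'.equivFin.symm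
  have hre : ∀ f : ι → ℝ, ∑ i, f (e i) = ∑ i ∈ s', f i := fun f => by
    rw [e.sum_comp (fun i : s' => f i), Finset.sum_coe_sort]
  have hmem : ∀ i, (e i : ι) ∈ s ∧ u (e i) < v (e i) := fun i => Finset.mem_filter.1 (e i).2
  have key := h s'.card (fun i => u (e i)) (fun i => v (e i))
    (fun i => ⟨(hs _ (hmem i).1).1, (hmem i).2, (hs _ (hmem i).1).2.2⟩)
    (fun i j hij => hd (hmem i).1 (hmem j).1 fun h => hij (e.injective (Subtype.ext h))) ?_
  · rw [hre (fun i => |F (v i) - F (u i)|)] at key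
    refine lt_of_eq_of_lt (Eq.symm ?_) key
    refine Finset.sum_filter_of_ne fun i hi hne => (hs i hi).2.1.lt_of_ne fun h => hne ?_
    rw [h, sub_self, abs_zero]
  · rw [hre (fun i => totalVar g (u i) (v i))]
    exact (Finset.sum_le_sum_of_subset_of_nonneg (Finset.filter_subset _ _)
      fun _ _ _ => ENNReal.toReal_nonneg).trans_lt hsum

/-- The steps of a partition form one admissible family, and their `g`-variations telescope to
`totalVar g (x 0) (x n)`, which is below `δ`. -/
theorem GAbsolutelyContinuousOn.exists_eVariationOn_le {g F : ℝ → ℝ} {a b : ℝ}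
    (hF : GAbsolutelyContinuousOn g a b F) (hg : IsDerivator g) {ε : ℝ} (hε : 0 < ε) :
    ∃ δ > 0, ∀ S ⊆ Icc a b, (∀ u ∈ S, ∀ v ∈ S, u ≤ v → totalVar g u v < δ) →
      eVariationOn F S ≤ ENNReal.ofReal ε := by
  obtain ⟨δ, hδ, h⟩ := hF.exists_finset hε
  refine ⟨δ, hδ, fun S hS hvar => iSup_le ?_⟩
  rintro ⟨n, x, hx, hxS⟩
  have hsum : ∑ i ∈ Finset.range n, totalVar g (x i) (x (i + 1)) = totalVar g (x 0) (x n) := by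
    rw [← hg.varFun_sub (hx n.zero_le), ← Finset.sum_range_sub (fun i => varFun g (x i))]
    exact Finset.sum_congr rfl fun i _ => (hg.varFun_sub (hx i.le_succ)).symm
  have key := h (Finset.range n) (fun i => x i) (fun i => x (i + 1))
    (fun i _ => ⟨(hS (hxS i)).1, hx i.le_succ, (hS (hxS _)).2⟩)
    (fun i _ j _ hij => hx.pairwise_disjoint_on_Ioo_succ hij)
    (hsum ▸ hvar _ (hxS 0) _ (hxS n) (hx n.zero_le))
  rw [← ENNReal.ofReal_toReal (ENNReal.sum_ne_top.2 fun i _ => edist_ne_top _ _),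
    ENNReal.toReal_sum fun _ _ => edist_ne_top _ _]
  refine ENNReal.ofReal_le_ofReal (le_trans (le_of_eq ?_) key.le)
  refine Finset.sum_congr rfl fun i _ => ?_
  rw [← dist_edist, Real.dist_eq]

theorem IsDerivator.tendsto_varFun_left {g : ℝ → ℝ} (hg : IsDerivator g) {a b t : ℝ}
    (ht : t ∈ Icc a b) :
    Tendsto (varFun g) (𝓝[Icc a b ∩ Iic t] t) (𝓝 (varFun g t)) := by
  set ν := hg.absMeasure a b
  have h : Tendsto (fun s => ν.real (Iio s)) (𝓝[≤] t) (𝓝 (ν.real (Iio t))) :=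
    continuousWithinAt_Iio_iff_Iic.1 (tendsto_measureReal_Iio_left ν t)
  have h2 := ((h.mono_left (nhdsWithin_mono _ (inter_subset_right (s := Icc a b)))).sub_const
    (ν.real (Iio t))).add_const (varFun g t)
  rw [sub_self, zero_add] at h2
  refine h2.congr' ?_
  filter_upwards [self_mem_nhdsWithin] with s hs
  rw [hg.absMeasure_real_Iio_sub ht hs.1]
  ring

theorem GAbsolutelyContinuousOn.leftCont {g F : ℝ → ℝ} {a b : ℝ}
    (hF : GAbsolutelyContinuousOn g a b F) (hg : IsDerivator g) {t : ℝ} (ht : t ∈ Icc a b) :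
    ContinuousWithinAt F (Icc a b ∩ Iic t) t := by
  refine Metric.tendsto_nhds.2 fun ε hε => ?_
  obtain ⟨δ, hδ, h⟩ := hF.exists_finset hε
  have hev := (hg.tendsto_varFun_left ht).eventually_const_lt (u := varFun g t - δ) (by linarith)
  filter_upwards [hev, self_mem_nhdsWithin] with s hs hs'
  have := h (Finset.univ : Finset Unit) (fun _ => s) (fun _ => t)
    (fun _ _ => ⟨hs'.1.1, hs'.2, ht.2⟩) (fun i _ j _ hij => absurd rfl hij) (by
      simp only [Finset.univ_unique, Finset.sum_const, Finset.card_singleton, one_smul]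
      rw [← hg.varFun_sub hs'.2]
      linarith)
  rw [dist_comm, Real.dist_eq]
  simpa using this

/-- A jump of `g` at `c` can exceed `δ`, so `c` is removed first: on `(c, y]` the variation of `g`
is small for `y` near `c`. Restoring `c` adds only the finite jump from `F c` to the right limit of
`F`. -/
theorem GAbsolutelyContinuousOn.exists_bv_right {g F : ℝ → ℝ} {a b : ℝ}
    (hF : GAbsolutelyContinuousOn g a b F) (hg : IsDerivator g) {c : ℝ} (hc : c ∈ Ico a b) :
    ∃ y ∈ Ioc c b, BoundedVariationOn F (Icc c y) := by
  obtain ⟨δ, hδ, h⟩ := hF.exists_eVariationOn_le hg one_pos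
  set ν := hg.absMeasure a b
  have hlim := tendsto_measureReal_Iio_right ν c
  obtain ⟨y, hy, hyb⟩ := ((hlim.eventually_lt_const (u := ν.real (Iic c) + δ)
    (by linarith)).and (Ioc_mem_nhdsGT hc.2)).exists
  refine ⟨y, hyb, ?_⟩
  have hioc : BoundedVariationOn F (Ioc c y) := by
    refine ne_top_of_le_ne_top ENNReal.ofReal_ne_top (h (Ioc c y)
      (fun x hx => ⟨hc.1.trans hx.1.le, hx.2.trans hyb.2⟩) fun u hu v hv huv => ?_)
    have hmem : ∀ x ∈ Ioc c y, x ∈ Icc a b := fun x hx => ⟨hc.1.trans hx.1.le, hx.2.trans hyb.2⟩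
    rw [← hg.varFun_sub huv, ← hg.absMeasure_real_Iio_sub (hmem u hu) (hmem v hv)]
    have h1 : ν.real (Iio v) ≤ ν.real (Iio y) := measureReal_mono (Iio_subset_Iio hv.2)
    have h2 : ν.real (Iic c) ≤ ν.real (Iio u) := measureReal_mono (Iic_subset_Iio.2 hu.1)
    change ν.real (Iio v) - ν.real (Iio u) < δ
    linarith
  obtain ⟨l, hl⟩ := hioc.exists_tendsto_right c
  have e1 : Icc c y ∩ Ici c = Icc c y := inter_eq_left.2 Icc_subset_Ici_self
  have e2 : Icc c y ∩ Ioi c = Ioc c y := by ext; simp; grind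
  have e3 : Ioc c y ∩ Ioi c = Ioc c y := inter_eq_left.2 Ioc_subset_Ioi_self
  have hne : (𝓝[Ioc c y] c).NeBot := by
    rw [nhdsWithin_Ioc_eq_nhdsGT hyb.1]
    infer_instance
  have key := eVariationOn.eVariationOn_on_inter_Ici_eq_Ioi_add_edist (f := F) (s := Icc c y)
    (a := c) (l := l) (by rwa [e2]) ⟨le_rfl, hyb.1.le⟩ (by rwa [e2, ← e3])
  rw [e1, e2] at key
  rw [BoundedVariationOn, key]
  exact ENNReal.add_ne_top.2 ⟨hioc, edist_ne_top _ _⟩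

/-- Large jumps forbid a subdivision into pieces of `g`-variation below `δ`, so the argument takes
the supremum `c` of the endpoints reached with bounded variation. Left-continuity of the variation
function shows that `c` is reached, and `exists_bv_right` passes beyond it if `c < b`. -/
theorem GAbsolutelyContinuousOn.boundedVariationOn {g F : ℝ → ℝ} {a b : ℝ}
    (hF : GAbsolutelyContinuousOn g a b F) (hg : IsDerivator g) (hab : a ≤ b) :
    BoundedVariationOn F (Icc a b) := by
  have hjoin : ∀ {x y z : ℝ}, x ≤ y → y ≤ z → BoundedVariationOn F (Icc x y) →
      BoundedVariationOn F (Icc y z) → BoundedVariationOn F (Icc x z) := by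
    intro x y z hxy hyz h1 h2
    have := eVariationOn.Icc_add_Icc F (s := univ) hxy hyz (mem_univ y)
    simp only [univ_inter] at this
    rw [BoundedVariationOn, ← this]
    exact ENNReal.add_ne_top.2 ⟨h1, h2⟩
  set S := {x ∈ Icc a b | BoundedVariationOn F (Icc a x)} with hS
  have haS : a ∈ S := ⟨⟨le_rfl, hab⟩, by simp⟩
  have hbdd : BddAbove S := ⟨b, fun x hx => hx.1.2⟩
  set c := sSup S with hc
  have hcab : c ∈ Icc a b := ⟨le_csSup hbdd haS, csSup_le ⟨a, haS⟩ fun x hx => hx.1.2⟩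
  have hcS : BoundedVariationOn F (Icc a c) := by
    rcases hcab.1.eq_or_lt with h | h
    · rw [← h]
      simp
    obtain ⟨δ, hδ, hvar⟩ := hF.exists_eVariationOn_le hg one_pos
    have hev := (hg.tendsto_varFun_left hcab).eventually_const_lt (u := varFun g c - δ)
      (by linarith)
    have hle : 𝓝[<] c ≤ 𝓝[Icc a b ∩ Iic c] c := by
      rw [← nhdsWithin_Ico_eq_nhdsLT h]
      exact nhdsWithin_mono _ fun x hx => ⟨⟨hx.1, hx.2.le.trans hcab.2⟩, hx.2.le⟩
    obtain ⟨s, hs, hsc⟩ := ((hev.filter_mono hle).and (Ico_mem_nhdsLT h)).exists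
    obtain ⟨x, hxS, hsx⟩ := exists_lt_of_lt_csSup ⟨a, haS⟩ hsc.2
    have hxc : x ≤ c := le_csSup hbdd hxS
    refine hjoin hxS.1.1 hxc hxS.2 (ne_top_of_le_ne_top ENNReal.ofReal_ne_top
      (hvar _ (Icc_subset_Icc hxS.1.1 hcab.2) fun u hu v hv huv => ?_))
    have h1 := hg.varFun_sub huv
    have h2 := hg.varFun_sub hv.2
    have h3 := hg.varFun_sub (hsx.le.trans hu.1)
    have h4 : 0 ≤ totalVar g v c := ENNReal.toReal_nonneg
    have h5 : 0 ≤ totalVar g s u := ENNReal.toReal_nonneg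
    linarith
  rcases hcab.2.eq_or_lt with h | h
  · rwa [← h]
  · obtain ⟨y, hy, hyF⟩ := hF.exists_bv_right hg ⟨hcab.1, h⟩
    exact absurd (le_csSup hbdd (show y ∈ S from
      ⟨⟨hcab.1.trans hy.1.le, hy.2⟩, hjoin hcab.1 hy.1.le hcS hyF⟩)) (not_le.2 hy.1)

/-- A `g`-absolutely continuous function is an indefinite integral with respect to `|μ_g|`. -/
theorem GAbsolutelyContinuousOn.exists_density {g F : ℝ → ℝ} {a b : ℝ}
    (hF : GAbsolutelyContinuousOn g a b F) (hg : IsDerivator g) (hab : a ≤ b) :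
    ∃ φ : ℝ → ℝ, Integrable φ (hg.absMeasure a b) ∧
      ∀ t ∈ Icc a b, F t = F a + ∫ x in Iio t, φ x ∂(hg.absMeasure a b) := by
  set ν := hg.absMeasure a b with hν
  set c : ℝ → ℝ := fun t => max a (min b t) with hcdef
  have hcm : Monotone c := fun x y hxy => max_le_max le_rfl (min_le_min le_rfl hxy)
  have hcmem : ∀ t, c t ∈ Icc a b := fun t => ⟨le_max_left _ _, max_le hab (min_le_left _ _)⟩
  have hbv : BoundedVariationOn (clamp F a b) univ :=
    ne_top_of_le_ne_top (hF.boundedVariationOn hg hab)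
      (eVariationOn.comp_le_of_monotoneOn F c (hcm.monotoneOn _) fun t _ => hcmem t)
  have hlc := continuousWithinAt_clamp hab fun t ht => hF.leftCont hg ht
  set m : SignedMeasure ℝ := hbv.vectorMeasure with hm
  have hmI : ∀ {x y : ℝ}, x ≤ y → m (Ico x y) = F (c y) - F (c x) := fun h =>
    vectorMeasure_Ico_of_leftCont hbv hlc h
  have hac : m ≪ᵥ ν.toENNRealVectorMeasure := by
    refine VectorMeasure.AbsolutelyContinuous.mk fun N hN hN0 => ?_
    rw [Measure.toENNRealVectorMeasure_apply_measurable hN] at hN0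
    refine abs_eq_zero.1 (le_antisymm (le_of_forall_pos_le_add fun ε hε => ?_) (abs_nonneg _))
    obtain ⟨δ, hδ, h⟩ := hF.exists_finset (half_pos hε)
    -- Approximating for the sum of the two measures gives one union of cells `T` that is close to
    -- `N` for `m` and has small mass for `ν`. On `T`, `g`-absolute continuity bounds the increments
    -- of `F`.
    obtain ⟨r, hr, s, hs⟩ := exists_grid_symmDiff_lt (m.totalVariation + ν) hN
      (ε := ENNReal.ofReal (min (ε / 2) δ)) (by simp [hε, hδ])
    set I : ℤ → Set ℝ := fun k => Ico (r * k) (r * (k + 1 : ℤ)) with hI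
    set T := ⋃ k ∈ s, I k with hT
    have hTm : MeasurableSet T := s.measurableSet_biUnion fun _ _ => measurableSet_Ico
    have hstep : ∀ k : ℤ, r * (k : ℝ) ≤ r * (k + 1 : ℤ) := fun k => by push_cast; nlinarith
    rw [Measure.add_apply] at hs
    have h1 : |m N - m T| ≤ ε / 2 := by
      refine (abs_signedMeasure_sub_le m hN hTm).trans
        (ENNReal.toReal_le_of_le_ofReal (by positivity) ?_)
      exact (le_self_add.trans hs.le).trans (ENNReal.ofReal_le_ofReal (min_le_left _ _))
    have h2 : ν.real T < δ := by
      have hle : ν T ≤ ν (N ∆ T) := by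
        calc ν T ≤ ν (N ∪ N ∆ T) := measure_mono fun x hx => by
              by_cases hxN : x ∈ N
              · exact Or.inl hxN
              · exact Or.inr (Or.inr ⟨hx, hxN⟩)
          _ ≤ ν N + ν (N ∆ T) := measure_union_le _ _
          _ = ν (N ∆ T) := by rw [hN0, zero_add]
      rw [measureReal_def, ← ENNReal.lt_ofReal_iff_toReal_lt (measure_ne_top _ _)]
      exact ((hle.trans le_add_self).trans_lt hs).trans_le
        (ENNReal.ofReal_le_ofReal (min_le_right _ _))
    have hsub : ∀ k : ℤ, Ico (c (r * k)) (c (r * (k + 1 : ℤ))) ⊆ I k := fun k x hx => by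
      simp only [hI, hcdef, mem_Ico] at hx ⊢
      grind
    have hdisj : Pairwise fun i j : ℤ => Disjoint (I i) (I j) := pairwise_disjoint_grid hr
    have h3 : ∑ k ∈ s, |F (c (r * (k + 1 : ℤ))) - F (c (r * k))| < ε / 2 := by
      refine h s (fun k => c (r * k)) (fun k => c (r * (k + 1 : ℤ)))
        (fun k _ => ⟨(hcmem _).1, hcm (hstep k), (hcmem _).2⟩)
        (fun i _ j _ hij => (hdisj hij).mono (Ioo_subset_Ico_self.trans (hsub i))
          (Ioo_subset_Ico_self.trans (hsub j))) (lt_of_le_of_lt ?_ h2)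
      calc ∑ k ∈ s, totalVar g (c (r * k)) (c (r * (k + 1 : ℤ)))
          = ∑ k ∈ s, ν.real (Ico (c (r * k)) (c (r * (k + 1 : ℤ)))) :=
            Finset.sum_congr rfl fun k _ =>
              (hg.absMeasure_real_Ico (hcmem _).1 (hcm (hstep k)) (hcmem _).2).symm
        _ ≤ ∑ k ∈ s, ν.real (I k) := Finset.sum_le_sum fun k _ => measureReal_mono (hsub k)
        _ = ν.real T := (measureReal_biUnion_finset (fun i _ j _ hij => hdisj hij)
            fun _ _ => measurableSet_Ico).symm
    have h4 : |m T| ≤ ε / 2 := by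
      rw [hT, VectorMeasure.of_biUnion_finset (fun i _ j _ hij => hdisj hij)
        fun _ _ => measurableSet_Ico]
      refine (Finset.abs_sum_le_sum_abs _ _).trans (le_of_eq_of_le ?_ h3.le)
      exact Finset.sum_congr rfl fun k _ => by rw [hmI (hstep k)]
    have h5 := abs_sub_abs_le_abs_sub (m N) (m T)
    linarith
  refine ⟨m.rnDeriv ν, SignedMeasure.integrable_rnDeriv _ _, fun t ht => ?_⟩
  have h1 := hmI ht.1
  have hct : c t = t := by rw [hcdef]; simp [ht.1, ht.2]
  have hca : c a = a := by rw [hcdef]; simp [hab]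
  rw [← SignedMeasure.withDensityᵥ_rnDeriv_eq m ν hac,
    withDensityᵥ_apply (SignedMeasure.integrable_rnDeriv _ _) measurableSet_Ico, hct, hca] at h1
  rw [hg.setIntegral_Iio_eq_Ico ht, ← hν]
  linarith

/-! ### From first order expansions to the `g`-derivative -/

/-- As `q ≠ 0`, the error is also negligible against `q * z`. The conclusion also shows that `z`
vanishes eventually wherever `y` does. -/
theorem isBigO_of_isLittleO_sub {l : Filter ℝ} {y z : ℝ → ℝ} {q : ℝ} (hq : q = 1 ∨ q = -1)
    (h : (fun s => y s - q * z s) =o[l] z) : z =O[l] y := by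
  have hq0 : q ≠ 0 := by rcases hq with rfl | rfl <;> norm_num
  have h1 : (fun s => y s - q * z s) =o[l] (fun s => q * z s) :=
    h.trans_isBigO (isBigO_self_const_mul hq0 z l)
  have h2 := (isBigO_self_const_mul hq0 z l).trans h1.right_isBigO_add
  simpa using h2

/-- The quotient of two functions comparable with a third one. -/
theorem tendsto_div_sub_of_isLittleO {l : Filter ℝ} {x y z : ℝ → ℝ} {p q : ℝ}
    (hq : q = 1 ∨ q = -1) (hx : (fun s => x s - p * z s) =o[l] z)
    (hy : (fun s => y s - q * z s) =o[l] z) :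
    Tendsto (fun s => (x s - p * q * y s) / y s) l (𝓝 0) := by
  refine IsLittleO.tendsto_div_nhds_zero (IsLittleO.trans_isBigO ?_ (isBigO_of_isLittleO_sub hq hy))
  -- The `z` terms cancel because `q * q = 1`.
  refine (hx.sub (hy.const_mul_left (p * q))).congr_left fun s => ?_
  have hqq : q * q = 1 := by rcases hq with rfl | rfl <;> norm_num
  linear_combination p * z s * hqq

/-- If the continuity conditions on the remainder at `t` amount to a limit along the filter `l`,
first order expansions along `l` determine the `g`-derivative at `t`. -/
theorem hasStieltjesDerivAt_of_isLittleO {g F G : ℝ → ℝ} {a b t p q : ℝ} {l : Filter ℝ}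
    (ht : t ∉ constSet g) (hlI : ∀ᶠ s in l, s ∈ Icc a b)
    (hl : ∀ h : ℝ → ℝ, h t = 0 →
      (Tendsto h l (𝓝 0) ↔
        (t ∉ constSet g ∪ jumpSet g ∪ (leftEnds g ∪ rightEnds g) →
          ContinuousWithinAt h (Icc a b) t) ∧
        (t ∈ jumpSet g ∪ rightEnds g → ContinuousWithinAt h (Icc a b ∩ Ici t) t) ∧
        (t ∈ leftEnds g → ContinuousWithinAt h (Icc a b ∩ Iic t) t)))
    (hq : q = 1 ∨ q = -1)
    (hF : (fun s => F s - F t - p * (G s - G t)) =o[l] (fun s => G s - G t))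
    (hg : (fun s => g s - g t - q * (G s - G t)) =o[l] (fun s => G s - G t))
    (hG : ∃ᶠ s in l, G s ≠ G t) :
    HasStieltjesDerivAt g a b F (p * q) t ∧
      ∀ d, HasStieltjesDerivAt g a b F d t → d = p * q := by
  have hstar : starPoint g t = t := if_neg ht
  have hlim := tendsto_div_sub_of_isLittleO (x := fun s => F s - F t) hq hF hg
  constructor
  · refine ⟨fun s => (F s - F t - p * q * (g s - g t)) / (g s - g t), ?_⟩
    rw [hstar]
    obtain ⟨h1, h2, h3⟩ := (hl _ (by simp)).1 hlim
    refine ⟨by simp, h1, h2, h3, fun s _ hs => ?_⟩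
    have : g s - g t ≠ 0 := sub_ne_zero.2 hs
    field_simp
    ring
  · rintro d ⟨h, h0, h1, h2, h3, heq⟩
    rw [hstar] at h0 h1 h2 h3 heq
    have hh := (hl h h0).2 ⟨h1, h2, h3⟩
    by_contra hd
    -- The two remainders differ by the constant `p * q - d` wherever `g s ≠ g t`, which by `hG` and
    -- `himp` happens frequently along `l`; but their difference tends to `0`.
    have hne := (hh.sub hlim).eventually_ne
      (b₂ := p * q - d) (by rw [sub_zero]; exact fun e => hd (by linarith))
    have himp : ∀ᶠ s in l, g s - g t = 0 → G s - G t = 0 :=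
      (isBigO_of_isLittleO_sub hq hg).eq_zero_imp
    obtain ⟨s, hGs, hs, himp, hsI⟩ := (hG.and_eventually (hne.and (himp.and hlI))).exists
    have hgs : g s - g t ≠ 0 := fun e => hGs (sub_eq_zero.1 (himp e))
    refine hs ?_
    rw [heq s hsI (sub_ne_zero.1 hgs)]
    field_simp
    ring

theorem stieltjesDeriv_eq {g F : ℝ → ℝ} {a b t d : ℝ} (h : HasStieltjesDerivAt g a b F d t)
    (hu : ∀ d', HasStieltjesDerivAt g a b F d' t → d' = d) : stieltjesDeriv g a b F t = d := by
  have hd : StieltjesDifferentiableAt g a b F t := ⟨d, h⟩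
  rw [stieltjesDeriv, dif_pos hd]
  exact hu _ hd.choose_spec

/-! ### Exceptional sets and differentiability almost everywhere -/

theorem IsDerivator.mem_jumpSet_iff {g : ℝ → ℝ} (hg : IsDerivator g) {a b t : ℝ}
    (ht : t ∈ Ico a b) : t ∈ jumpSet g ↔ hg.absMeasure a b {t} ≠ 0 := by
  set ν := hg.absMeasure a b with hν
  have hlim : Tendsto (varFun g) (𝓝[>] t) (𝓝 (varFun g t + ν.real {t})) := by
    have h := ((tendsto_measureReal_Iio_right ν t).sub_const (ν.real (Iio t))).const_add (varFun g t)
    rw [measureReal_Iic_eq_add, add_sub_cancel_left] at h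
    refine h.congr' ?_
    filter_upwards [Ioc_mem_nhdsGT ht.2] with s hs
    rw [hg.absMeasure_real_Iio_sub ⟨ht.1, ht.2.le⟩ ⟨ht.1.trans hs.1.le, hs.2⟩]
    ring
  rw [jumpSet, mem_ofPred_eq, rightLim_eq_of_tendsto hlim, add_sub_cancel_left, measureReal_def,
    ENNReal.toReal_pos_iff, pos_iff_ne_zero]
  exact and_iff_left (measure_lt_top _ _)

theorem IsDerivator.ae_mem_Ico {g : ℝ → ℝ} (hg : IsDerivator g) {a b : ℝ} (hab : a ≤ b) :
    ∀ᵐ t ∂hg.absMeasure a b, t ∈ Ico a b := by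
  filter_upwards [measure_eq_zero_iff_ae_notMem.1 (hg.absMeasure_Iio hab),
    measure_eq_zero_iff_ae_notMem.1 (hg.absMeasure_Ici hab)] with t h1 h2
  exact ⟨not_lt.1 h1, not_le.1 h2⟩

/-- Each point of `C_g` in `[a, b)` has a neighbourhood whose trace on `[a, b)` is null, since the
variation function is constant near it; locally null sets are null. -/
theorem IsDerivator.ae_notMem_constSet {g : ℝ → ℝ} (hg : IsDerivator g) {a b : ℝ} (hab : a ≤ b) :
    ∀ᵐ t ∂hg.absMeasure a b, t ∉ constSet g := by
  have h : hg.absMeasure a b (constSet g ∩ Ico a b) = 0 := by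
    refine measure_null_of_locally_null _ fun x hx => ?_
    obtain ⟨⟨ε, hε, hconst⟩, hxa, hxb⟩ := hx
    refine ⟨Ioo (x - ε / 2) (x + ε / 2) ∩ Ico a b,
      mem_nhdsWithin.2 ⟨Ioo (x - ε / 2) (x + ε / 2), isOpen_Ioo,
        ⟨by linarith, by linarith⟩, fun y hy => ⟨hy.1, hy.2.2⟩⟩, ?_⟩
    have hu : max a (x - ε / 2) ≤ x := max_le hxa (by linarith)
    have hv : x ≤ min b (x + ε / 2) := le_min hxb.le (by linarith)
    refine measure_mono_null (t := Ico (max a (x - ε / 2)) (min b (x + ε / 2)))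
      (fun y hy => ⟨max_le hy.2.1 hy.1.1.le, lt_min hy.2.2 hy.1.2⟩) ?_
    have hu' : varFun g (max a (x - ε / 2)) = varFun g x :=
      hconst _ ⟨by linarith [le_max_right a (x - ε / 2)], by linarith⟩
    have hv' : varFun g (min b (x + ε / 2)) = varFun g x :=
      hconst _ ⟨by linarith, by linarith [min_le_right b (x + ε / 2)]⟩
    rw [← measureReal_eq_zero_iff,
      hg.absMeasure_real_Ico (le_max_left _ _) (hu.trans hv) (min_le_left _ _),
      ← hg.varFun_sub (hu.trans hv), hu', hv', sub_self]
  filter_upwards [measure_eq_zero_iff_ae_notMem.1 h, hg.ae_mem_Ico hab] with t h1 h2 h3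
  exact h1 ⟨h3, h2⟩

/-- A left endpoint is isolated on the right in the complement of `C_g`, and a subset of the line
has only countably many such points. -/
theorem countable_leftEnds (g : ℝ → ℝ) : (leftEnds g).Countable := by
  refine (countable_setOfPred_isolated_right_within (s := (constSet g)ᶜ)).mono ?_
  rintro x ⟨⟨hx, y, hxy, hsub⟩, -⟩
  refine ⟨hx, ?_⟩
  rw [← empty_mem_iff_bot, mem_nhdsWithin]
  refine ⟨Iio y, isOpen_Iio, hxy, fun z hz => ?_⟩
  exact hz.2.1 (hsub ⟨hz.2.2, hz.1⟩)

theorem countable_rightEnds (g : ℝ → ℝ) : (rightEnds g).Countable := by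
  refine (countable_setOfPred_isolated_left_within (s := (constSet g)ᶜ)).mono ?_
  rintro y ⟨⟨hy, x, hxy, hsub⟩, -⟩
  refine ⟨hy, ?_⟩
  rw [← empty_mem_iff_bot, mem_nhdsWithin]
  refine ⟨Ioi x, isOpen_Ioi, hxy, fun z hz => ?_⟩
  exact hz.2.1 (hsub ⟨hz.1, hz.2.2⟩)

/-- Almost every point that belongs to a countable set is an atom. -/
theorem ae_notMem_of_countable (ν : Measure ℝ) {N : Set ℝ} (hN : N.Countable) :
    ∀ᵐ t ∂ν, ν {t} = 0 → t ∉ N := by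
  have h : ν (⋃ t ∈ {t ∈ N | ν {t} = 0}, {t}) = 0 :=
    (measure_biUnion_null_iff (hN.mono (sep_subset _ _))).2 fun t ht => ht.2
  rw [biUnion_of_singleton] at h
  filter_upwards [measure_eq_zero_iff_ae_notMem.1 h] with t h1 h2 h3
  exact h1 ⟨h3, h2⟩

/-- An indefinite integral with respect to `|μ_g|` is `g`-differentiable almost everywhere. -/
theorem IsDerivator.ae_hasStieltjesDerivAt {g : ℝ → ℝ} (hg : IsDerivator g) {a b : ℝ}
    (hab : a ≤ b) {F φ ψ : ℝ → ℝ} (hφ : Integrable φ (hg.absMeasure a b))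
    (hF : ∀ t ∈ Icc a b, F t = F a + ∫ x in Iio t, φ x ∂(hg.absMeasure a b))
    (hψ : Integrable ψ (hg.absMeasure a b)) (hψ1 : ∀ x, ψ x = 1 ∨ ψ x = -1)
    (hgψ : ∀ t ∈ Icc a b, g t = g a + ∫ x in Iio t, ψ x ∂(hg.absMeasure a b)) :
    ∀ᵐ t ∂hg.absMeasure a b, HasStieltjesDerivAt g a b F (φ t * ψ t) t ∧
      ∀ d, HasStieltjesDerivAt g a b F d t → d = φ t * ψ t := by
  set ν := hg.absMeasure a b with hν
  set Γ : ℝ → ℝ := fun s => ν.real (Iio s) with hΓ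
  -- Including `a` ensures that a remaining point that is not an atom is interior to `[a, b]`, so
  -- that two-sided limits are available.
  have hN : (leftEnds g ∪ rightEnds g ∪ {a}).Countable :=
    ((countable_leftEnds g).union (countable_rightEnds g)).union (countable_singleton a)
  filter_upwards [hg.ae_mem_Ico hab, hg.ae_notMem_constSet hab, ae_notMem_of_countable ν hN,
    ae_isLittleO_setIntegral_Iio ν hφ, ae_isLittleO_setIntegral_Iio ν hψ]
    with t htI htC htN hoφ hoψ
  have htI' : t ∈ Icc a b := ⟨htI.1, htI.2.le⟩
  have transfer : ∀ {f χ : ℝ → ℝ} {l : Filter ℝ}, (∀ᶠ s in l, s ∈ Icc a b) →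
      (∀ t ∈ Icc a b, f t = f a + ∫ x in Iio t, χ x ∂ν) →
      (fun s => ∫ x in Iio s, χ x ∂ν - ∫ x in Iio t, χ x ∂ν - χ t * (Γ s - Γ t)) =o[l]
        (fun s => Γ s - Γ t) →
      (fun s => f s - f t - χ t * (Γ s - Γ t)) =o[l] (fun s => Γ s - Γ t) := by
    intro f χ l hl hf ho
    refine ho.congr' ?_ EventuallyEq.rfl
    filter_upwards [hl] with s hs
    rw [hf s hs, hf t htI']
    ring
  by_cases h0 : ν {t} = 0
  · have hlI : ∀ᶠ s in 𝓝[Icc a b] t, s ∈ Icc a b := self_mem_nhdsWithin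
    have htD : t ∉ jumpSet g := fun h => (hg.mem_jumpSet_iff htI).1 h h0
    have htN := htN h0
    have htL : t ∉ leftEnds g := fun h => htN (Or.inl (Or.inl h))
    have htR : t ∉ rightEnds g := fun h => htN (Or.inl (Or.inr h))
    have hta : a < t := htI.1.lt_of_ne fun h => htN (Or.inr h.symm)
    have hnhds : 𝓝[Icc a b] t = 𝓝 t := nhdsWithin_eq_nhds.2 (Icc_mem_nhds hta htI.2)
    refine hasStieltjesDerivAt_of_isLittleO (G := Γ) (l := 𝓝[Icc a b] t) htC hlI
      (fun h hh => ?_) (hψ1 t)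
      (transfer hlI hF ((hoφ h0).mono nhdsWithin_le_nhds))
      (transfer hlI hgψ ((hoψ h0).mono nhdsWithin_le_nhds)) ?_
    · simp [htC, htD, htL, htR, ContinuousWithinAt, hh]
    -- If `Γ` were constant near `t`, so would be the variation function, putting `t` in `C_g`.
    · intro hev
      refine htC ?_
      have hev' : ∀ᶠ s in 𝓝 t, varFun g s = varFun g t := by
        rw [← hnhds]
        filter_upwards [hev, hlI] with s hs hsI
        have := hg.absMeasure_real_Iio_sub htI' hsI
        rw [← hν] at this
        have h2 : Γ s = Γ t := not_not.1 hs
        simp only [hΓ] at h2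
        linarith
      obtain ⟨ε, hε, hball⟩ := Metric.eventually_nhds_iff_ball.1 hev'
      exact ⟨ε, hε, fun s hs => hball s (by rwa [Real.ball_eq_Ioo])⟩
  · have htD : t ∈ jumpSet g := (hg.mem_jumpSet_iff htI).2 h0
    have htL : t ∉ leftEnds g := fun h => h.2 htD
    have hlI : ∀ᶠ s in 𝓝[Icc a b ∩ Ioi t] t, s ∈ Icc a b :=
      mem_of_superset self_mem_nhdsWithin inter_subset_left
    -- Right-continuity at an atom involves `t` itself; since `h t = 0`, it is the same as a limit
    -- over `s > t`.
    have hins : Icc a b ∩ Ici t = insert t (Icc a b ∩ Ioi t) := by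
      ext s
      simp only [mem_inter_iff, mem_Icc, mem_Ici, mem_insert_iff, mem_Ioi]
      grind
    have hle : 𝓝[Icc a b ∩ Ioi t] t ≤ 𝓝[>] t := nhdsWithin_mono _ inter_subset_right
    have hge : 𝓝[>] t ≤ 𝓝[Icc a b ∩ Ioi t] t := by
      rw [← nhdsWithin_Ioc_eq_nhdsGT htI.2]
      exact nhdsWithin_mono _ fun s hs => ⟨⟨htI.1.trans hs.1.le, hs.2⟩, hs.1⟩
    refine hasStieltjesDerivAt_of_isLittleO (G := Γ) (l := 𝓝[Icc a b ∩ Ioi t] t) htC hlI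
      (fun h hh => ?_) (hψ1 t)
      (transfer hlI hF ((isLittleO_setIntegral_Iio_of_atom ν hφ h0).mono hle))
      (transfer hlI hgψ ((isLittleO_setIntegral_Iio_of_atom ν hψ h0).mono hle)) ?_
    · rw [hins, continuousWithinAt_insert_self]
      simp [htD, htL, ContinuousWithinAt, hh]
    · have hlim := tendsto_measureReal_Iio_right ν t
      have hne : ν.real (Iic t) ≠ ν.real (Iio t) := by
        rw [measureReal_Iic_eq_add]
        simpa [measureReal_def, ENNReal.toReal_eq_zero_iff] using h0
      exact ((hlim.eventually_ne hne).frequently).filter_mono hge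

/-! ### The converse and the conclusion -/

/-- An indefinite integral with respect to `μ_g` is `g`-absolutely continuous. -/
theorem IsDerivator.gAbsolutelyContinuousOn_of_integral {g : ℝ → ℝ} (hg : IsDerivator g)
    {a b : ℝ} (hab : a ≤ b) {F f : ℝ → ℝ} (hf : IntegrableOn f (Ico a b) (hg.absMeasure a b))
    (hF : ∀ t ∈ Icc a b, F t = F a + hg.integral a b (Ico a t) f) :
    GAbsolutelyContinuousOn g a b F := by
  obtain ⟨ψ, hψm, hψ1, hψ, -⟩ := hg.exists_sign_density hab
  set ν := hg.absMeasure a b with hν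
  have hinc : ∀ u v, a ≤ u → u ≤ v → v ≤ b →
      ENNReal.ofReal |F v - F u| ≤ ∫⁻ x in Ico u v, ‖f x‖ₑ ∂ν := by
    intro u v hau huv hvb
    have hv : IntegrableOn f (Ico a v) ν := hf.mono_set (Ico_subset_Ico_right hvb)
    have hvψ : IntegrableOn (fun x => f x * ψ x) (Ico a v) ν :=
      Integrable.mul_bdd (c := 1) hv hψm.aestronglyMeasurable (Eventually.of_forall fun x => by
        rcases hψ1 x with h | h <;> simp [h])
    have heq : F v - F u = ∫ x in Ico u v, f x * ψ x ∂ν := by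
      rw [hF v ⟨hau.trans huv, hvb⟩, hF u ⟨hau, huv.trans hvb⟩, hψ _ _ measurableSet_Ico hv,
        hψ _ _ measurableSet_Ico (hv.mono_set (Ico_subset_Ico_right huv)),
        ← Ico_union_Ico_eq_Ico hau huv, setIntegral_union _ measurableSet_Ico
          (hvψ.mono_set (Ico_subset_Ico_right huv)) (hvψ.mono_set (Ico_subset_Ico_left hau))]
      · ring
      · exact disjoint_left.2 fun x hx hx' => absurd hx.2 (not_lt.2 hx'.1)
    rw [heq, ← Real.norm_eq_abs, ofReal_norm]
    refine (enorm_integral_le_lintegral_enorm _).trans (lintegral_mono fun x => le_of_eq ?_)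
    rcases hψ1 x with h | h <;> simp [h]
  intro ε hε
  obtain ⟨δ, hδ, h⟩ := exists_pos_setLIntegral_lt_of_measure_lt (μ := ν.restrict (Ico a b))
    (f := fun x => ‖f x‖ₑ) hf.2.ne (ε := ENNReal.ofReal ε) (by simpa using hε)
  have hδ1 : min δ 1 ≠ ∞ := ne_top_of_le_ne_top ENNReal.one_ne_top (min_le_right _ _)
  -- Here `δ` may be infinite; the minimum with `1` makes the threshold a real number.
  refine ⟨(min δ 1).toReal, ENNReal.toReal_pos (by simp [hδ.ne']) hδ1, ?_⟩
  intro m u v huv hd hsum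
  -- Disjoint nonempty open intervals share no left endpoint, so the half-open ones are disjoint and
  -- the masses add up.
  have hdI : Pairwise fun i j => Disjoint (Ico (u i) (v i)) (Ico (u j) (v j)) := fun i j hij =>
    Ico_disjoint_Ico.2 (Ioo_disjoint_Ioo.1 (hd hij))
  have hdI' : (↑(Finset.univ : Finset (Fin m)) : Set (Fin m)).PairwiseDisjoint
    fun i => Ico (u i) (v i) := fun i _ j _ hij => hdI hij
  set T := ⋃ i ∈ (Finset.univ : Finset (Fin m)), Ico (u i) (v i) with hT
  have hTm : MeasurableSet T := Finset.measurableSet_biUnion _ fun _ _ => measurableSet_Ico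
  have hTI : T ⊆ Ico a b := iUnion₂_subset fun i _ => Ico_subset_Ico (huv i).1 (huv i).2.2
  have hTν : ν T < min δ 1 := by
    rw [← ENNReal.toReal_lt_toReal (measure_ne_top _ _) hδ1]
    refine lt_of_eq_of_lt ?_ hsum
    rw [← measureReal_def, hT, measureReal_biUnion_finset hdI' fun _ _ => measurableSet_Ico]
    exact Finset.sum_congr rfl fun i _ =>
      hg.absMeasure_real_Ico (huv i).1 (huv i).2.1.le (huv i).2.2
  have hTr : (ν.restrict (Ico a b)).restrict T = ν.restrict T := by
    rw [Measure.restrict_restrict hTm, inter_eq_left.2 hTI]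
  have key := h T (by
    rw [Measure.restrict_apply hTm, inter_eq_left.2 hTI]
    exact hTν.trans_le (min_le_left _ _))
  rw [hTr, hT, lintegral_biUnion_finset hdI' fun _ _ => measurableSet_Ico] at key
  rw [← ENNReal.ofReal_lt_ofReal_iff hε, ENNReal.ofReal_sum_of_nonneg fun _ _ => abs_nonneg _]
  exact (Finset.sum_le_sum fun i _ =>
    hinc _ _ (huv i).1 (huv i).2.1.le (huv i).2.2).trans_lt key

end StieltjesFTC

theorem mainTheorem2 (g : ℝ → ℝ) (hg : StieltjesFTC.IsDerivator g) (a b : ℝ) (hab : a < b)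
    (ha : a ∉ StieltjesFTC.leftEnds g)
    (hb : b ∉ StieltjesFTC.constSet g ∪ StieltjesFTC.rightEnds g ∪ StieltjesFTC.jumpSet g)
    (F : ℝ → ℝ) :
    StieltjesFTC.GAbsolutelyContinuousOn g a b F ↔
      (∀ᵐ t ∂(hg.absMeasure a b).restrict (Set.Icc a b),
          StieltjesFTC.StieltjesDifferentiableAt g a b F t) ∧
        MeasureTheory.IntegrableOn (StieltjesFTC.stieltjesDeriv g a b F) (Set.Ico a b)
          (hg.absMeasure a b) ∧
        ∀ t ∈ Set.Icc a b,
          F t = F a + hg.integral a b (Set.Ico a t) (StieltjesFTC.stieltjesDeriv g a b F) := by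
  constructor
  · intro hF
    obtain ⟨φ, hφ, hφF⟩ := hF.exists_density hg hab.le
    obtain ⟨ψ, hψm, hψ1, hψ, hψg⟩ := hg.exists_sign_density hab.le
    have hψb : ∀ x, ‖ψ x‖ ≤ 1 := fun x => by rcases hψ1 x with h | h <;> simp [h]
    have hψi : MeasureTheory.Integrable ψ (hg.absMeasure a b) :=
      MeasureTheory.Integrable.of_bound hψm.aestronglyMeasurable 1
        (Filter.Eventually.of_forall hψb)
    have hae := hg.ae_hasStieltjesDerivAt hab.le hφ hφF hψi hψ1
      fun t ht => by rw [← hψg t ht]; ring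
    have hderiv : StieltjesFTC.stieltjesDeriv g a b F =ᵐ[hg.absMeasure a b]
        fun t => φ t * ψ t := by
      filter_upwards [hae] with t ht
      exact StieltjesFTC.stieltjesDeriv_eq ht.1 ht.2
    have hint : MeasureTheory.Integrable (StieltjesFTC.stieltjesDeriv g a b F)
        (hg.absMeasure a b) :=
      (hφ.mul_bdd hψm.aestronglyMeasurable (Filter.Eventually.of_forall hψb)).congr hderiv.symm
    refine ⟨?_, hint.integrableOn, fun t ht => ?_⟩
    · refine MeasureTheory.ae_restrict_of_ae ?_
      filter_upwards [hae] with t ht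
      exact ⟨_, ht.1⟩
    · rw [hψ _ _ measurableSet_Ico hint.integrableOn, hφF t ht, hg.setIntegral_Iio_eq_Ico ht]
      congr 1
      refine MeasureTheory.integral_congr_ae (MeasureTheory.ae_restrict_of_ae ?_)
      filter_upwards [hderiv] with x hx
      rw [hx]
      -- The two signs cancel: `φ x * ψ x * ψ x = φ x`.
      rcases hψ1 x with h | h <;> simp [h]
  · rintro ⟨-, hint, hF⟩
    exact hg.gAbsolutelyContinuousOn_of_integral hab.le hint hF
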